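/- Let $n\ge 1$, let $\Omega\subset\mathbb R^n$ be a bounded domain with Lipschitz boundary, let $T>0$ and $Q=\Omega\times(0,T]$. For $1\le p\le\infty$ let $$W^{2,1}_p(Q)=\{f\in L^p(Q): f_t, f_{x_k}, f_{x_kx_\ell}\in L^p(Q),\ 1\le k,\ell\le n\},\qquad W^{1,0}_p(Q)=\{f\in L^p(Q): f_{x_k}\in L^p(Q),\ 1\le k\le n\}$$ (weak derivatives), with the norms $$\|f\|_{W^{2,1}_p(Q)}=\|f\|_{L^p(Q)}+\|f_t\|_{L^p(Q)}+\sum_{k}\|f_{x_k}\|_{L^p(Q)}+\sum_{k,\ell}\|f_{x_kx_\ell}\|_{L^p(Q)},\qquad \|f\|_{W^{1,0}_p(Q)}=\|f\|_{L^p(Q)}+\sum_{k}\|f_{x_k}\|_{L^p(Q)}.$$ Assume that $1\le p\le r\le\infty$ satisfy one of the following conditions: (i) $p<n+2$ and $p\le r<\dfrac{p(n+2)}{n+2-p}$; (ii) $p=n+2\le r<\infty$; (iii) $n+2<p<\infty$ and $r=\infty$. Then $W^{2,1}_p(Q)$ is compactly imbedded in $W^{1,0}_r(Q)$; that is, $W^{2,1}_p(Q)\subset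 W^{1,0}_r(Q)$ and the inclusion map is a continuous, compact linear operator. -/

import Mathlib

open MeasureTheory TopologicalSpace
open scoped ENNReal NNReal ContDiff

namespace ParabolicSobolev

/-- Euclidean space `ℝⁿ`. -/
abbrev E (n : ℕ) : Type := EuclideanSpace ℝ (Fin n)

/-- The boundary of `Ω` is Lipschitz: near each of its points, `Ω` is, in suitable orthogonal
coordinates, the strict epigraph of a Lipschitz function. Here `e` is the vertical unit vector,
`inner ℝ e y` the vertical coordinate of `y` and `y - inner ℝ e y • e` its projection to the
hyperplane orthogonal to `e`. -/
def HasLipschitzBoundary {n : ℕ} (Ω : Set (E n)) : Prop :=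
  ∀ x ∈ frontier Ω, ∃ (e : E n) (γ : E n → ℝ) (K : ℝ≥0) (ρ : ℝ),
    ‖e‖ = 1 ∧ LipschitzWith K γ ∧ 0 < ρ ∧
      ∀ y ∈ Metric.ball x ρ, y ∈ Ω ↔ γ (y - inner ℝ e y • e) < inner ℝ e y

/-- The parabolic cylinder `Q = Ω × (0, T]`. -/
def cylinder {n : ℕ} (Ω : Opens (E n)) (T : ℝ) : Set (E n × ℝ) :=
  (Ω : Set (E n)) ×ˢ Set.Ioc 0 T

/-- Lebesgue measure on `Q`. -/
noncomputable def cylMeasure {n : ℕ} (Ω : Opens (E n)) (T : ℝ) : Measure (E n × ℝ) :=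
  volume.restrict (cylinder Ω T)

/-- The spatial coordinate direction `x_k` in space-time. -/
noncomputable def dirX {n : ℕ} (k : Fin n) : E n × ℝ := (EuclideanSpace.single k 1, 0)

/-- The time direction in space-time. -/
def dirT {n : ℕ} : E n × ℝ := (0, 1)

/-- Classical iterated directional derivative along a list of directions. -/
noncomputable def iterDeriv {n : ℕ} : List (E n × ℝ) → (E n × ℝ → ℝ) → E n × ℝ → ℝ
  | [], φ => φ
  | v :: vs, φ => fun z => fderiv ℝ (iterDeriv vs φ) z v

/-- Test functions: smooth with compact support in the open cylinder `Ω × (0, T)`. -/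
def IsTest {n : ℕ} (Ω : Opens (E n)) (T : ℝ) (φ : E n × ℝ → ℝ) : Prop :=
  ContDiff ℝ ∞ φ ∧ HasCompactSupport φ ∧ tsupport φ ⊆ (Ω : Set (E n)) ×ˢ Set.Ioo 0 T

/-- `g` is the weak derivative of `f` in `Q` along the list of directions `vs`. It is used for
`f`, `g` in `L^p(Q)`, so that the integrands are integrable. -/
def HasWeakDeriv {n : ℕ} (Ω : Opens (E n)) (T : ℝ) (vs : List (E n × ℝ))
    (f g : E n × ℝ → ℝ) : Prop :=
  ∀ φ : E n × ℝ → ℝ, IsTest Ω T φ →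
    ∫ z, f z * iterDeriv vs φ z ∂(cylMeasure Ω T) =
      (-1) ^ vs.length * ∫ z, g z * φ z ∂(cylMeasure Ω T)

section Helpers

variable {n : ℕ} {Ω : Opens (E n)} {T : ℝ} {p : ℝ≥0∞}

instance : IsLocallyFiniteMeasure (cylMeasure Ω T) := by
  unfold cylMeasure; infer_instance

theorem contDiff_iterDeriv (vs : List (E n × ℝ)) {φ : E n × ℝ → ℝ} (h : ContDiff ℝ ∞ φ) :
    ContDiff ℝ ∞ (iterDeriv vs φ) := by
  induction vs with
  | nil => exact h
  | cons v vs ih =>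
    exact (ih.fderiv_right (m := ∞) (by simp)).clm_apply contDiff_const

theorem hasCompactSupport_iterDeriv (vs : List (E n × ℝ)) {φ : E n × ℝ → ℝ}
    (h : HasCompactSupport φ) : HasCompactSupport (iterDeriv vs φ) := by
  induction vs with
  | nil => exact h
  | cons v vs ih => exact ih.fderiv_apply (𝕜 := ℝ) v

theorem integrable_mul [Fact (1 ≤ p)] (f : Lp ℝ p (cylMeasure Ω T)) {ψ : E n × ℝ → ℝ}
    (hψ : ContDiff ℝ ∞ ψ) (hc : HasCompactSupport ψ) :
    Integrable (fun z => f z * ψ z) (cylMeasure Ω T) := by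
  have hf : LocallyIntegrable f (cylMeasure Ω T) := (Lp.memLp f).locallyIntegrable Fact.out
  simpa [mul_comm] using
    hf.integrable_smul_left_of_hasCompactSupport hψ.continuous hc

/-- Uniqueness of the weak derivative. -/
theorem HasWeakDeriv.unique [Fact (1 ≤ p)] {vs : List (E n × ℝ)} {f : E n × ℝ → ℝ}
    {g h : Lp ℝ p (cylMeasure Ω T)} (hg : HasWeakDeriv Ω T vs f g)
    (hh : HasWeakDeriv Ω T vs f h) : g = h := by
  have hU : IsOpen ((Ω : Set (E n)) ×ˢ Set.Ioo 0 T) := Ω.isOpen.prod isOpen_Ioo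
  have key := hU.ae_eq_zero_of_integral_contDiff_smul_eq_zero (μ := cylMeasure Ω T)
    (f := fun z => g z - h z)
    ((((Lp.memLp g).locallyIntegrable Fact.out).sub
      ((Lp.memLp h).locallyIntegrable Fact.out)).locallyIntegrableOn _) (by
      intro φ h1 h2 h3
      have e := (hg φ ⟨h1, h2, h3⟩).symm.trans (hh φ ⟨h1, h2, h3⟩)
      have e' := mul_left_cancel₀ (pow_ne_zero _ (by norm_num)) e
      have : ∀ z, φ z • (g z - h z) = g z * φ z - h z * φ z := fun z => by
        simp only [smul_eq_mul]; ring
      simp only [this]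
      rw [integral_sub (integrable_mul g h1 h2) (integrable_mul h h1 h2), e', sub_self])
  have hT : ∀ᵐ z ∂(volume : Measure (E n × ℝ)), z.2 ≠ T := by
    have : (volume : Measure (E n × ℝ)) (Set.univ ×ˢ {T}) = 0 := by
      rw [Measure.volume_eq_prod, Measure.prod_prod]; simp
    rw [ae_iff]
    convert this using 2
    ext z; simp
  have hQ : ∀ᵐ z ∂(cylMeasure Ω T), z ∈ cylinder Ω T :=
    ae_restrict_mem (Ω.isOpen.measurableSet.prod measurableSet_Ioc)
  have hT' : ∀ᵐ z ∂(cylMeasure Ω T), z.2 ≠ T := ae_restrict_of_ae hT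
  refine Lp.ext ?_
  filter_upwards [key, hQ, hT'] with z h1 h2 h3
  exact sub_eq_zero.1 (h1 ⟨h2.1, h2.2.1, lt_of_le_of_ne h2.2.2 h3⟩)

theorem HasWeakDeriv.add [Fact (1 ≤ p)] {vs : List (E n × ℝ)} {f f' g g' : Lp ℝ p (cylMeasure Ω T)}
    (h : HasWeakDeriv Ω T vs f g) (h' : HasWeakDeriv Ω T vs f' g') :
    HasWeakDeriv Ω T vs (f + f' : Lp ℝ p (cylMeasure Ω T))
      (g + g' : Lp ℝ p (cylMeasure Ω T)) := by
  intro φ hφ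
  have aux : ∀ (a b : Lp ℝ p (cylMeasure Ω T)) (ψ : E n × ℝ → ℝ), ContDiff ℝ ∞ ψ →
      HasCompactSupport ψ →
      ∫ z, (a + b : Lp ℝ p (cylMeasure Ω T)) z * ψ z ∂(cylMeasure Ω T) =
        ∫ z, a z * ψ z ∂(cylMeasure Ω T) + ∫ z, b z * ψ z ∂(cylMeasure Ω T) := by
    intro a b ψ h1 h2
    rw [← integral_add (integrable_mul a h1 h2) (integrable_mul b h1 h2)]
    refine integral_congr_ae ?_
    filter_upwards [Lp.coeFn_add a b] with z hz
    rw [hz, Pi.add_apply, add_mul]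
  rw [aux _ _ _ (contDiff_iterDeriv vs hφ.1) (hasCompactSupport_iterDeriv vs hφ.2.1),
    aux _ _ _ hφ.1 hφ.2.1, h φ hφ, h' φ hφ, mul_add]

theorem HasWeakDeriv.smul {vs : List (E n × ℝ)} {f g : Lp ℝ p (cylMeasure Ω T)} (c : ℝ)
    (h : HasWeakDeriv Ω T vs f g) :
    HasWeakDeriv Ω T vs (c • f : Lp ℝ p (cylMeasure Ω T))
      (c • g : Lp ℝ p (cylMeasure Ω T)) := by
  intro φ hφ
  have aux : ∀ (a : Lp ℝ p (cylMeasure Ω T)) (ψ : E n × ℝ → ℝ),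
      ∫ z, (c • a : Lp ℝ p (cylMeasure Ω T)) z * ψ z ∂(cylMeasure Ω T) =
        c * ∫ z, a z * ψ z ∂(cylMeasure Ω T) := by
    intro a ψ
    rw [← integral_const_mul]
    refine integral_congr_ae ?_
    filter_upwards [Lp.coeFn_smul c a] with z hz
    rw [hz, Pi.smul_apply, smul_eq_mul, mul_assoc]
  rw [aux, aux, h φ hφ]; ring

theorem HasWeakDeriv.zero (vs : List (E n × ℝ)) :
    HasWeakDeriv Ω T vs (0 : Lp ℝ p (cylMeasure Ω T)) (0 : Lp ℝ p (cylMeasure Ω T)) := by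
  intro φ _
  have h0 : ∀ ψ : E n × ℝ → ℝ,
      ∫ z, (0 : Lp ℝ p (cylMeasure Ω T)) z * ψ z ∂(cylMeasure Ω T) = 0 := by
    intro ψ
    refine integral_eq_zero_of_ae ?_
    filter_upwards [Lp.coeFn_zero ℝ p (cylMeasure Ω T)] with z hz
    rw [hz]; simp
  rw [h0, h0, mul_zero]

end Helpers

section Space

variable {n : ℕ} (Ω : Opens (E n)) (T : ℝ) (p : ℝ≥0∞) [Fact (1 ≤ p)]
variable {ι : Type} (D : ι → List (E n × ℝ))

/-- The functions of `L^p(Q)` whose weak derivatives `D i`, `i ∈ ι`, all lie in `L^p(Q)`. -/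
def sobolevSubmodule : Submodule ℝ (Lp ℝ p (cylMeasure Ω T)) where
  carrier := {f | ∀ i, ∃ g : Lp ℝ p (cylMeasure Ω T), HasWeakDeriv Ω T (D i) f g}
  add_mem' := fun ha hb i =>
    ⟨(ha i).choose + (hb i).choose, (ha i).choose_spec.add (hb i).choose_spec⟩
  zero_mem' := fun i => ⟨0, HasWeakDeriv.zero (D i)⟩
  smul_mem' := fun c _ ha i => ⟨c • (ha i).choose, (ha i).choose_spec.smul c⟩

/-- The Sobolev space of the family `D`, as a type of its own: it carries its own norm below, not
the `L^p` norm of the submodule. -/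
def Sobolev : Type := sobolevSubmodule Ω T p D

noncomputable instance : AddCommGroup (Sobolev Ω T p D) :=
  inferInstanceAs (AddCommGroup (sobolevSubmodule Ω T p D))

noncomputable instance : Module ℝ (Sobolev Ω T p D) :=
  inferInstanceAs (Module ℝ (sobolevSubmodule Ω T p D))

variable {Ω T p D}

/-- The element of `L^p(Q)` underlying an element of the Sobolev space. -/
noncomputable def Sobolev.toLp : Sobolev Ω T p D →ₗ[ℝ] Lp ℝ p (cylMeasure Ω T) :=
  (sobolevSubmodule Ω T p D).subtype

/-- The weak derivative `D i f`. -/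
noncomputable def Sobolev.wderiv (i : ι) (f : Sobolev Ω T p D) : Lp ℝ p (cylMeasure Ω T) :=
  (f.2 i).choose

theorem Sobolev.hasWeakDeriv (i : ι) (f : Sobolev Ω T p D) :
    HasWeakDeriv Ω T (D i) f.toLp (f.wderiv i) :=
  (f.2 i).choose_spec

/-- The map `f ↦ (f, (D i f)_i)`, with the `ℓ¹` sum of the `L^p` norms on the target. -/
noncomputable def Sobolev.jet :
    Sobolev Ω T p D →ₗ[ℝ] PiLp 1 (fun _ : Option ι => Lp ℝ p (cylMeasure Ω T)) where
  toFun f := WithLp.toLp 1 fun o => o.elim f.toLp fun i => f.wderiv i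
  map_add' f g := by
    ext1 o
    cases o with
    | none => simp
    | some i =>
      refine ((f + g).hasWeakDeriv i).unique ?_
      simpa using (f.hasWeakDeriv i).add (g.hasWeakDeriv i)
  map_smul' c f := by
    ext1 o
    cases o with
    | none => simp
    | some i =>
      refine ((c • f).hasWeakDeriv i).unique ?_
      simpa using (f.hasWeakDeriv i).smul c

theorem Sobolev.jet_injective :
    Function.Injective (Sobolev.jet : Sobolev Ω T p D →ₗ[ℝ] _) := by
  intro f g h
  exact Subtype.ext (congrArg (fun F => F.ofLp none) h)

variable [Fintype ι]

noncomputable instance : NormedAddCommGroup (Sobolev Ω T p D) :=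
  NormedAddCommGroup.induced _ _ Sobolev.jet Sobolev.jet_injective

noncomputable instance : NormedSpace ℝ (Sobolev Ω T p D) :=
  NormedSpace.induced ℝ (Sobolev Ω T p D) _ Sobolev.jet

/-- The norm is the sum of the `L^p(Q)` norms of `f` and of its weak derivatives `D i f`. -/
theorem Sobolev.norm_eq (f : Sobolev Ω T p D) : ‖f‖ = ‖f.toLp‖ + ∑ i, ‖f.wderiv i‖ := by
  change ‖Sobolev.jet f‖ = _
  rw [PiLp.norm_eq_of_nat 1 (by simp)]
  simp [Sobolev.jet, Fintype.sum_option]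

end Space

/-- The derivatives `u_t`, `u_{x_k}`, `u_{x_k x_l}`. -/
noncomputable def derivs21 (n : ℕ) : Unit ⊕ Fin n ⊕ (Fin n × Fin n) → List (E n × ℝ)
  | Sum.inl _ => [dirT]
  | Sum.inr (Sum.inl k) => [dirX k]
  | Sum.inr (Sum.inr (k, l)) => [dirX l, dirX k]

/-- The derivatives `u_{x_k}`. -/
noncomputable def derivs10 (n : ℕ) : Fin n → List (E n × ℝ) := fun k => [dirX k]

/-- The parabolic Sobolev space `W^{2,1}_p(Q)`, with norm
`‖f‖ + ‖f_t‖ + ∑ k, ‖f_{x_k}‖ + ∑ k l, ‖f_{x_k x_l}‖` (norms in `L^p(Q)`). -/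
abbrev W21 {n : ℕ} (Ω : Opens (E n)) (T : ℝ) (p : ℝ≥0∞) [Fact (1 ≤ p)] : Type :=
  Sobolev Ω T p (derivs21 n)

/-- The parabolic Sobolev space `W^{1,0}_p(Q)`, with norm `‖f‖ + ∑ k, ‖f_{x_k}‖`
(norms in `L^p(Q)`). -/
abbrev W10 {n : ℕ} (Ω : Opens (E n)) (T : ℝ) (p : ℝ≥0∞) [Fact (1 ≤ p)] : Type :=
  Sobolev Ω T p (derivs10 n)

theorem W21.norm_eq {n : ℕ} {Ω : Opens (E n)} {T : ℝ} {p : ℝ≥0∞} [Fact (1 ≤ p)]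
    (f : W21 Ω T p) :
    ‖f‖ = ‖f.toLp‖ + ‖f.wderiv (Sum.inl ())‖ + ∑ k, ‖f.wderiv (Sum.inr (Sum.inl k))‖ +
      ∑ k, ∑ l, ‖f.wderiv (Sum.inr (Sum.inr (k, l)))‖ := by
  rw [Sobolev.norm_eq, Fintype.sum_sum_type, Fintype.sum_sum_type, Fintype.sum_prod_type]
  simp [add_assoc]

end ParabolicSobolev

/-!
Fix a bump `φ` whose parabolic dilates, placed at a point of `Q`, stay in a space-time cone inside
`Q`, and average `u` against these dilates by `(x, t) ↦ (λ x, λ² t)`. The derivative of such an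
average in the scale `λ` is the integral of `u` against a divergence, hence is controlled by the
local integrals of `u_t`, `u_{x_k}` and `u_{x_k x_l}`. Telescoping over dyadic scales, the distance
in `L^r` from `u` or `u_{x_k}` to its average at scale `δ` is at most a constant times `δ^θ ‖u‖`,
with `θ = 1 - (n + 2) (1/p - 1/r)`, and the hypotheses on `p` and `r` say exactly that `θ > 0`.
At a fixed scale the averages depend, up to a small error, on finitely many linear functionals of
`u`. An operator whose norm is, up to `ε ‖u‖`, bounded by finitely many functionals is compact.
-/

namespace ParabolicSobolev

section LpBounds

variable {α : Type*} [MeasurableSpace α] {μ : Measure α}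

theorem eLpNorm_le_rpow_mul_eLpNorm_rpow_of_enorm_le {ε : Type*} [TopologicalSpace ε]
    [ESeminormedAddMonoid ε] {f : α → ε} (hf : AEStronglyMeasurable f μ) {A : ℝ≥0∞}
    (hfA : ∀ᵐ x ∂μ, ‖f x‖ₑ ≤ A) {p r : ℝ≥0∞} (hp : p ≠ 0) (hpt : p ≠ ⊤) (hpr : p ≤ r) :
    eLpNorm f r μ ≤
      A ^ (1 - p.toReal / r.toReal) * eLpNorm f p μ ^ (p.toReal / r.toReal) := by
  rcases eq_or_ne r ⊤ with rfl | hrt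
  · simpa using eLpNormEssSup_le_of_ae_enorm_bound hfA
  have hq0 : 0 < p.toReal := ENNReal.toReal_pos hp hpt
  have hqs : p.toReal ≤ r.toReal := ENNReal.toReal_mono hrt hpr
  have hs0 : 0 < r.toReal := hq0.trans_le hqs
  rw [eLpNorm_eq_lintegral_rpow_enorm_toReal (hp.bot_lt.trans_le hpr).ne' hrt,
    eLpNorm_eq_lintegral_rpow_enorm_toReal hp hpt, ← ENNReal.rpow_mul, one_div, one_div,
    inv_mul_eq_div, div_div_cancel_left' hq0.ne', ENNReal.rpow_inv_le_iff hs0,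
    ENNReal.mul_rpow_of_nonneg _ _ hs0.le, ENNReal.rpow_inv_rpow hs0.ne', ← ENNReal.rpow_mul,
    sub_mul, one_mul, div_mul_cancel₀ _ hs0.ne',
    ← lintegral_const_mul'' _ (hf.enorm.pow_const _)]
  refine lintegral_mono_ae (hfA.mono fun x hx => ?_)
  nth_rewrite 1 [← sub_add_cancel r.toReal p.toReal]
  rw [ENNReal.rpow_add_of_nonneg _ _ (sub_nonneg.2 hqs) hq0.le]
  gcongr

theorem eLpNorm_add_measure_le {ε : Type*} [TopologicalSpace ε] [ContinuousENorm ε] {r : ℝ≥0∞}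
    (hr : 1 ≤ r) (f : α → ε) (ν : Measure α) :
    eLpNorm f r (μ + ν) ≤ eLpNorm f r μ + eLpNorm f r ν := by
  rcases eq_or_ne r ⊤ with rfl | hrt
  · simp only [eLpNorm_exponent_top]
    exact essSup_le_of_ae_le _ (ae_add_measure_iff.2
      ⟨(enorm_ae_le_eLpNormEssSup f μ).mono fun x hx => hx.trans le_self_add,
        (enorm_ae_le_eLpNormEssSup f ν).mono fun x hx => hx.trans le_add_self⟩)
  have hs : 1 ≤ r.toReal := by simpa using ENNReal.toReal_mono hrt hr
  simp only [eLpNorm_eq_lintegral_rpow_enorm_toReal (one_pos.trans_le hr).ne' hrt,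
    lintegral_add_measure, one_div]
  exact ENNReal.rpow_add_le_add_rpow _ _ (by positivity) (inv_le_one_of_one_le₀ hs)

theorem eLpNorm_restrict_union_le {ε : Type*} [TopologicalSpace ε] [ContinuousENorm ε] {r : ℝ≥0∞}
    (hr : 1 ≤ r) (f : α → ε) (s t : Set α) :
    eLpNorm f r (μ.restrict (s ∪ t)) ≤
      eLpNorm f r (μ.restrict s) + eLpNorm f r (μ.restrict t) :=
  (eLpNorm_mono_measure f (Measure.restrict_union_le s t)).trans (eLpNorm_add_measure_le hr f _)

theorem eLpNorm_sub_le_tsum_of_tendstoInMeasure {E : Type*} [NormedAddCommGroup E] {F : ℕ → α → E}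
    {f : α → E} (hF : ∀ j, AEStronglyMeasurable (F j) μ)
    (hFf : TendstoInMeasure μ F Filter.atTop f) {r : ℝ≥0∞} (hr : 1 ≤ r) :
    eLpNorm (f - F 0) r μ ≤ ∑' j, eLpNorm (F (j + 1) - F j) r μ := by
  obtain ⟨ns, -, hae⟩ := hFf.exists_seq_tendsto_ae
  have hpartial : ∀ N, eLpNorm (F N - F 0) r μ ≤ ∑' j, eLpNorm (F (j + 1) - F j) r μ := fun N => by
    rw [← Finset.sum_range_sub]
    exact (eLpNorm_sum_le (fun j _ => (hF (j + 1)).sub (hF j)) hr).trans (ENNReal.sum_le_tsum _)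
  refine (Lp.eLpNorm_lim_le_liminf_eLpNorm (fun k => (hF (ns k)).sub (hF 0)) _
    (hae.mono fun x hx => hx.sub_const (F 0 x))).trans ?_
  exact (Filter.liminf_le_liminf (.of_forall fun k => hpartial (ns k))).trans_eq
    (Filter.liminf_const _)

end LpBounds

section LocalIntegrals

variable {α : Type*} [MeasurableSpace α] {μ : Measure α} {g : α → ℝ≥0∞}

theorem setLIntegral_le_rpow_mul_measure_rpow (s : Set α) {q : ℝ} (hq : 1 ≤ q)
    (hg : AEMeasurable g μ) :
    ∫⁻ w in s, g w ∂μ ≤ (∫⁻ w in s, g w ^ q ∂μ) ^ q⁻¹ * μ s ^ (1 - q⁻¹) := by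
  simpa only [eLpNorm', enorm_eq_self, ENNReal.rpow_one, one_div, inv_one,
    Measure.restrict_apply_univ] using
    eLpNorm'_le_eLpNorm'_mul_rpow_measure_univ (μ := μ.restrict s) one_pos hq
      hg.restrict.aestronglyMeasurable

variable {B : α → Set α} (hB : MeasurableSet {x : α × α | x.2 ∈ B x.1})

include hB

theorem lintegral_indicator_prodMk (g : α → ℝ≥0∞) (z : α) :
    ∫⁻ w, {x : α × α | x.2 ∈ B x.1}.indicator (fun x => g x.2) (z, w) ∂μ =
      ∫⁻ w in B z, g w ∂μ :=
  lintegral_indicator (measurable_prodMk_left hB) g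

theorem measurable_setLIntegral [SFinite μ] (hg : Measurable g) :
    Measurable fun z => ∫⁻ w in B z, g w ∂μ := by
  simp only [← lintegral_indicator_prodMk hB]
  exact ((hg.comp measurable_snd).indicator hB).lintegral_prod_right'

variable (hsymm : ∀ z w, w ∈ B z → z ∈ B w) {V : ℝ≥0∞} (hV : ∀ z, μ (B z) ≤ V)

include hV

include hsymm in
theorem lintegral_setLIntegral_le [SFinite μ] (hg : Measurable g) :
    ∫⁻ z, ∫⁻ w in B z, g w ∂μ ∂μ ≤ V * ∫⁻ w, g w ∂μ := by
  simp only [← lintegral_indicator_prodMk hB]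
  rw [lintegral_lintegral_swap
      (f := fun z w => {x : α × α | x.2 ∈ B x.1}.indicator (fun x => g x.2) (z, w))
      ((hg.comp measurable_snd).indicator hB).aemeasurable,
    ← lintegral_const_mul _ hg]
  refine lintegral_mono fun w => ?_
  refine (lintegral_indicator_const (measurable_prodMk_right (y := w) hB) (g w)).trans_le ?_
  rw [mul_comm]
  gcongr
  exact (measure_mono fun z hz => hsymm z w hz).trans (hV w)

omit hB in
theorem setLIntegral_le_rpow_mul_eLpNorm {p : ℝ≥0∞} (hp : 1 ≤ p) (hpt : p ≠ ⊤)
    (hg : Measurable g) (z : α) :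
    ∫⁻ w in B z, g w ∂μ ≤ V ^ (1 - p.toReal⁻¹) * eLpNorm g p μ := by
  have hq : 1 ≤ p.toReal := by simpa using ENNReal.toReal_mono hpt hp
  rw [eLpNorm_eq_lintegral_rpow_enorm_toReal (one_pos.trans_le hp).ne' hpt, mul_comm]
  simp only [enorm_eq_self, one_div]
  refine (setLIntegral_le_rpow_mul_measure_rpow _ hq hg.aemeasurable).trans ?_
  gcongr
  · exact Measure.restrict_le_self
  · exact sub_nonneg.2 (inv_le_one_of_one_le₀ hq)
  · exact hV z

include hsymm in
theorem eLpNorm_setLIntegral_le_mul_eLpNorm [SFinite μ] {p : ℝ≥0∞} (hp : 1 ≤ p) (hpt : p ≠ ⊤)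
    (hg : Measurable g) :
    eLpNorm (fun z => ∫⁻ w in B z, g w ∂μ) p μ ≤ V * eLpNorm g p μ := by
  have hp0 : p ≠ 0 := (one_pos.trans_le hp).ne'
  have hq : 1 ≤ p.toReal := by simpa using ENNReal.toReal_mono hpt hp
  have hq0 : 0 < p.toReal := one_pos.trans_le hq
  simp only [eLpNorm_eq_lintegral_rpow_enorm_toReal hp0 hpt, enorm_eq_self, one_div]
  rw [ENNReal.rpow_inv_le_iff hq0, ENNReal.mul_rpow_of_nonneg _ _ hq0.le,
    ENNReal.rpow_inv_rpow hq0.ne']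
  calc ∫⁻ z, (∫⁻ w in B z, g w ∂μ) ^ p.toReal ∂μ
      ≤ ∫⁻ z, V ^ (p.toReal - 1) * ∫⁻ w in B z, g w ^ p.toReal ∂μ ∂μ := by
        refine lintegral_mono fun z => ?_
        refine (ENNReal.rpow_le_rpow (setLIntegral_le_rpow_mul_measure_rpow _ hq hg.aemeasurable)
          hq0.le).trans ?_
        rw [ENNReal.mul_rpow_of_nonneg _ _ hq0.le, ENNReal.rpow_inv_rpow hq0.ne',
          ← ENNReal.rpow_mul, sub_mul, one_mul, inv_mul_cancel₀ hq0.ne', mul_comm]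
        gcongr
        exact hV z
    _ ≤ V ^ (p.toReal - 1) * (V * ∫⁻ w, g w ^ p.toReal ∂μ) := by
        rw [lintegral_const_mul _ (measurable_setLIntegral hB (hg.pow_const _))]
        gcongr
        exact lintegral_setLIntegral_le hB hsymm hV (hg.pow_const _)
    _ = V ^ p.toReal * ∫⁻ w, g w ^ p.toReal ∂μ := by
        nth_rewrite 2 [← ENNReal.rpow_one V]
        rw [← mul_assoc, ← ENNReal.rpow_add_of_nonneg _ _ (sub_nonneg.2 hq) zero_le_one,
          sub_add_cancel]

include hsymm in
theorem eLpNorm_setLIntegral_le [SFinite μ] {p r : ℝ≥0∞} (hp : 1 ≤ p) (hpt : p ≠ ⊤) (hpr : p ≤ r)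
    (hg : Measurable g) :
    eLpNorm (fun z => ∫⁻ w in B z, g w ∂μ) r μ ≤
      V ^ (1 - p.toReal⁻¹ + r.toReal⁻¹) * eLpNorm g p μ := by
  have hq : 1 ≤ p.toReal := by simpa using ENNReal.toReal_mono hpt hp
  have hinv : 0 ≤ 1 - p.toReal⁻¹ := sub_nonneg.2 (inv_le_one_of_one_le₀ hq)
  set t := p.toReal / r.toReal with ht
  have ht0 : 0 ≤ t := by positivity
  have ht1 : 0 ≤ 1 - t := by
    rcases eq_or_ne r ⊤ with rfl | hrt
    · simp [ht]
    · exact sub_nonneg.2 (div_le_one_of_le₀ (ENNReal.toReal_mono hrt hpr) ENNReal.toReal_nonneg)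
  have hsum : (1 - p.toReal⁻¹) * (1 - t) + t = 1 - p.toReal⁻¹ + r.toReal⁻¹ := by
    have : p.toReal⁻¹ * t = r.toReal⁻¹ := by
      rw [ht, div_eq_mul_inv, inv_mul_cancel_left₀ (one_pos.trans_le hq).ne']
    linear_combination this
  calc eLpNorm (fun z => ∫⁻ w in B z, g w ∂μ) r μ
      ≤ (V ^ (1 - p.toReal⁻¹) * eLpNorm g p μ) ^ (1 - t) *
          eLpNorm (fun z => ∫⁻ w in B z, g w ∂μ) p μ ^ t :=
        eLpNorm_le_rpow_mul_eLpNorm_rpow_of_enorm_le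
          (measurable_setLIntegral hB hg).aestronglyMeasurable
          (.of_forall (setLIntegral_le_rpow_mul_eLpNorm hV hp hpt hg))
          (one_pos.trans_le hp).ne' hpt hpr
    _ ≤ (V ^ (1 - p.toReal⁻¹) * eLpNorm g p μ) ^ (1 - t) * (V * eLpNorm g p μ) ^ t := by
        gcongr
        exact eLpNorm_setLIntegral_le_mul_eLpNorm hB hsymm hV hp hpt hg
    _ = V ^ (1 - p.toReal⁻¹ + r.toReal⁻¹) * eLpNorm g p μ := by
        rw [ENNReal.mul_rpow_of_nonneg _ _ ht1, ENNReal.mul_rpow_of_nonneg _ _ ht0,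
          ← ENNReal.rpow_mul, mul_mul_mul_comm,
          ← ENNReal.rpow_add_of_nonneg _ _ (mul_nonneg hinv ht1) ht0,
          ← ENNReal.rpow_add_of_nonneg _ _ ht1 ht0, hsum, sub_add_cancel, ENNReal.rpow_one]

end LocalIntegrals

section CompactnessCriterion

variable {X : Type*} [NormedAddCommGroup X] [NormedSpace ℝ X] {q q' : X → ℝ≥0∞}

/-- Up to an arbitrarily small multiple of the norm, `q` is bounded by finitely many continuous
linear functionals. For `q u = ‖J u‖ₑ` with `J` a bounded operator into a Banach space, this is
compactness of `J` in the form in which it is proved here. -/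
def SmallModuloFunctionals (q : X → ℝ≥0∞) : Prop :=
  ∀ ε : ℝ≥0, 0 < ε → ∃ L : List (X →L[ℝ] ℝ), ∀ u,
    q u ≤ ε * ‖u‖ₑ + (L.map fun l => ‖l u‖ₑ).sum

namespace SmallModuloFunctionals

theorem zero : SmallModuloFunctionals fun _ : X => (0 : ℝ≥0∞) := fun _ _ => ⟨[], by simp⟩

theorem mono (h : SmallModuloFunctionals q') (hq : ∀ u, q u ≤ q' u) : SmallModuloFunctionals q :=
  fun ε hε => (h ε hε).imp fun _ hL u => (hq u).trans (hL u)

theorem add (h : SmallModuloFunctionals q) (h' : SmallModuloFunctionals q') :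
    SmallModuloFunctionals fun u => q u + q' u := fun ε hε => by
  obtain ⟨L, hL⟩ := h (ε / 2) (half_pos hε)
  obtain ⟨L', hL'⟩ := h' (ε / 2) (half_pos hε)
  refine ⟨L ++ L', fun u => (add_le_add (hL u) (hL' u)).trans_eq ?_⟩
  rw [List.map_append, List.sum_append, add_add_add_comm, ← add_mul, ← ENNReal.coe_add, add_halves]

theorem sum {ι : Type*} (s : Finset ι) {Q : ι → X → ℝ≥0∞}
    (h : ∀ i ∈ s, SmallModuloFunctionals (Q i)) :
    SmallModuloFunctionals fun u => ∑ i ∈ s, Q i u := by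
  classical
  induction s using Finset.induction_on with
  | empty => simpa only [Finset.sum_empty] using zero
  | insert a s ha ih =>
    simp only [Finset.sum_insert ha]
    exact (h a (Finset.mem_insert_self a s)).add
      (ih fun i hi => h i (Finset.mem_insert_of_mem hi))

theorem const_mul (h : SmallModuloFunctionals q) (c : ℝ≥0) :
    SmallModuloFunctionals fun u => c * q u := fun ε hε => by
  obtain ⟨L, hL⟩ := h (ε / (c + 1)) (by positivity)
  refine ⟨L.map fun l => (c : ℝ) • l, fun u => (mul_le_mul_right (hL u) (c : ℝ≥0∞)).trans ?_⟩
  have hc : c * (ε / (c + 1)) ≤ ε := by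
    rw [mul_div_left_comm]
    exact mul_le_of_le_one_right' (div_le_one_of_le₀ (le_add_of_nonneg_right zero_le_one) zero_le)
  rw [mul_add, ← mul_assoc, ← List.sum_map_mul_left, List.map_map]
  refine add_le_add (mul_le_mul_left (by exact_mod_cast hc) _) (le_of_eq ?_)
  refine congrArg List.sum (List.map_congr_left fun l _ => ?_)
  simp

theorem comp {X' : Type*} [NormedAddCommGroup X'] [NormedSpace ℝ X']
    (h : SmallModuloFunctionals q) (D : X' →L[ℝ] X) :
    SmallModuloFunctionals fun u => q (D u) := fun ε hε => by
  obtain ⟨L, hL⟩ := h (ε / (‖D‖₊ + 1)) (by positivity)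
  refine ⟨L.map fun l => l.comp D, fun u => (hL (D u)).trans ?_⟩
  have hD : ε / (‖D‖₊ + 1) * ‖D‖₊ ≤ ε := by
    rw [div_mul_eq_mul_div, mul_div_assoc]
    exact mul_le_of_le_one_right' (div_le_one_of_le₀ (le_add_of_nonneg_right zero_le_one) zero_le)
  rw [List.map_map]
  refine add_le_add ?_ le_rfl
  calc ((ε / (‖D‖₊ + 1) : ℝ≥0) : ℝ≥0∞) * ‖D u‖ₑ
      ≤ (ε / (‖D‖₊ + 1) : ℝ≥0) * (‖D‖ₑ * ‖u‖ₑ) := by gcongr; exact D.le_opENorm u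
    _ = ((ε / (‖D‖₊ + 1) * ‖D‖₊ : ℝ≥0) : ℝ≥0∞) * ‖u‖ₑ := by
        rw [ENNReal.coe_mul, mul_assoc, enorm_eq_nnnorm D]
    _ ≤ ε * ‖u‖ₑ := by gcongr

theorem biSup_of_totallyBounded {S : Set (X →L[ℝ] ℝ)} (hS : TotallyBounded S) :
    SmallModuloFunctionals fun u => ⨆ l ∈ S, ‖l u‖ₑ := fun ε hε => by
  obtain ⟨t, -, htf, ht⟩ := Metric.finite_approx_of_totallyBounded hS ε hε
  refine ⟨htf.toFinset.toList, fun u => iSup₂_le fun l hl => ?_⟩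
  obtain ⟨l', hl', hll'⟩ := Set.mem_iUnion₂.1 (ht hl)
  have hdist : ‖l - l'‖ₑ ≤ ε := by
    rw [Metric.mem_ball, dist_eq_norm] at hll'
    exact enorm_le_coe.2 hll'.le
  have hmem : ‖l' u‖ₑ ∈ htf.toFinset.toList.map fun l => ‖l u‖ₑ :=
    List.mem_map_of_mem (Finset.mem_toList.2 (htf.mem_toFinset.2 hl'))
  calc ‖l u‖ₑ = ‖(l - l') u + l' u‖ₑ := by rw [sub_apply, sub_add_cancel]
    _ ≤ ‖(l - l') u‖ₑ + ‖l' u‖ₑ := enorm_add_le _ _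
    _ ≤ ‖l - l'‖ₑ * ‖u‖ₑ + (htf.toFinset.toList.map fun l => ‖l u‖ₑ).sum :=
        add_le_add ((l - l').le_opENorm u) (List.single_le_sum (fun _ _ => zero_le) _ hmem)
    _ ≤ ε * ‖u‖ₑ + (htf.toFinset.toList.map fun l => ‖l u‖ₑ).sum := by gcongr

theorem exists_le_mul_enorm (h : SmallModuloFunctionals q) : ∃ C : ℝ≥0, ∀ u, q u ≤ C * ‖u‖ₑ := by
  obtain ⟨L, hL⟩ := h 1 one_pos
  refine ⟨1 + (L.map fun l => ‖l‖₊).sum, fun u => (hL u).trans ?_⟩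
  have hcoe : ((L.map fun l => ‖l‖₊).sum : ℝ≥0∞) = (L.map fun l => ‖l‖ₑ).sum := by
    exact (map_list_sum ENNReal.ofNNRealHom _).trans (congrArg List.sum List.map_map)
  rw [ENNReal.coe_add, add_mul, hcoe, ← List.sum_map_mul_right]
  gcongr
  exact List.sum_le_sum fun l _ => l.le_opENorm u

theorem exists_le_add_enorm_pi (h : SmallModuloFunctionals q) {ε : ℝ≥0} (hε : 0 < ε) :
    ∃ (m : ℕ) (Λ : X →L[ℝ] Fin m → ℝ), ∀ u, q u ≤ ε * ‖u‖ₑ + ‖Λ u‖ₑ := by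
  obtain ⟨L, hL⟩ := h ε hε
  refine ⟨L.length, (L.length : ℝ) • ContinuousLinearMap.pi fun i => L.get i,
    fun u => (hL u).trans ?_⟩
  have hsum : (L.map fun l => ‖l u‖ₑ).sum ≤
      (L.map fun l => ‖l u‖ₑ).length • ‖ContinuousLinearMap.pi (fun i => L.get i) u‖ₑ := by
    refine List.sum_le_card_nsmul _ _ fun x hx => ?_
    obtain ⟨l, hl, rfl⟩ := List.mem_map.1 hx
    obtain ⟨i, rfl⟩ := List.get_of_mem hl
    exact enorm_le_iff_norm_le.2 (norm_le_pi_norm (ContinuousLinearMap.pi (fun i => L.get i) u) i)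
  gcongr
  simpa [enorm_smul] using hsum

variable {Y : Type*} [NormedAddCommGroup Y] [NormedSpace ℝ Y] {J : X →L[ℝ] Y}

theorem totallyBounded_image_closedBall (h : SmallModuloFunctionals fun u => ‖J u‖ₑ) :
    TotallyBounded (J '' Metric.closedBall 0 1) := by
  refine Metric.totallyBounded_iff.2 fun ε hε => ?_
  lift ε to ℝ≥0 using hε.le
  rw [gt_iff_lt, NNReal.coe_pos] at hε
  obtain ⟨m, Λ, hΛ⟩ := h.exists_le_add_enorm_pi (ε := ε / 4) (by positivity)
  have hJ : ∀ u, ‖J u‖ ≤ ε / 4 * ‖u‖ + ‖Λ u‖ := fun u => by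
    have := hΛ u
    simp only [enorm_eq_nnnorm] at this
    exact_mod_cast this
  have hb : TotallyBounded (Λ '' Metric.closedBall 0 1) :=
    ((Metric.isBounded_closedBall.image Λ).isCompact_closure.totallyBounded).subset subset_closure
  obtain ⟨t, hts, htf, ht⟩ := Metric.finite_approx_of_totallyBounded hb (ε / 2) (by positivity)
  choose! v hv hvt using fun y (hy : y ∈ t) => hts hy
  refine ⟨(fun y => J (v y)) '' t, htf.image _, ?_⟩
  rintro _ ⟨u, hu, rfl⟩
  obtain ⟨y, hy, huy⟩ := Set.mem_iUnion₂.1 (ht ⟨u, hu, rfl⟩)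
  refine Set.mem_iUnion₂.2 ⟨_, ⟨y, hy, rfl⟩, ?_⟩
  have hdist : ‖u - v y‖ ≤ 2 := by
    linarith [norm_sub_le u (v y), mem_closedBall_zero_iff.1 hu,
      mem_closedBall_zero_iff.1 (hv y hy)]
  have hΛdist : ‖Λ (u - v y)‖ < ε / 2 := by
    rw [map_sub, hvt y hy, ← dist_eq_norm]
    exact huy
  rw [Metric.mem_ball, dist_eq_norm, ← map_sub]
  nlinarith [hJ (u - v y)]

theorem isCompactOperator [CompleteSpace Y] (h : SmallModuloFunctionals fun u => ‖J u‖ₑ) :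
    IsCompactOperator J :=
  (isCompactOperator_iff_exists_mem_nhds_isCompact_closure_image _).2
    ⟨_, Metric.closedBall_mem_nhds 0 one_pos,
      h.totallyBounded_image_closedBall.closure.isCompact_of_isClosed isClosed_closure⟩

end SmallModuloFunctionals

end CompactnessCriterion

section ParabolicScaling

variable {n : ℕ}

/-- The parabolic dilation `(y, s) ↦ (a y, a² s)`. -/
noncomputable def parabolicDilation (a : ℝ) : E n × ℝ →L[ℝ] E n × ℝ :=
  (a • ContinuousLinearMap.fst ℝ (E n) ℝ).prod (a ^ 2 • ContinuousLinearMap.snd ℝ (E n) ℝ)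

theorem parabolicDilation_apply (a : ℝ) (v : E n × ℝ) :
    parabolicDilation a v = (a • v.1, a ^ 2 * v.2) := rfl

theorem parabolicDilation_parabolicDilation_inv {a : ℝ} (ha : a ≠ 0) (v : E n × ℝ) :
    parabolicDilation a (parabolicDilation a⁻¹ v) = v := by
  ext <;> simp [parabolicDilation_apply, ha]

theorem parabolicDilation_dirX (a : ℝ) (k : Fin n) :
    parabolicDilation a (dirX k) = a • dirX k := by
  simp [parabolicDilation_apply, dirX]

theorem parabolicDilation_dirT (a : ℝ) :
    parabolicDilation a (dirT : E n × ℝ) = a ^ 2 • dirT := by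
  simp [parabolicDilation_apply, dirT]

/-- The parabolic box of radius `R` at scale `ρ` around `z`: it has width of order `ρ` in space
and `ρ²` in time. -/
def parabolicBox (R ρ : ℝ) (z : E n × ℝ) : Set (E n × ℝ) :=
  Metric.closedBall z.1 (R * ρ) ×ˢ Metric.closedBall z.2 (R * ρ ^ 2)

theorem mem_parabolicBox_symm {R ρ : ℝ} {z w : E n × ℝ} (h : w ∈ parabolicBox R ρ z) :
    z ∈ parabolicBox R ρ w :=
  ⟨Metric.mem_closedBall_comm.1 h.1, Metric.mem_closedBall_comm.1 h.2⟩

theorem parabolicBox_mono {R ρ ρ' : ℝ} (hR : 0 ≤ R) (hρ : 0 ≤ ρ) (h : ρ ≤ ρ') (z : E n × ℝ) :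
    parabolicBox R ρ z ⊆ parabolicBox R ρ' z :=
  Set.prod_mono (Metric.closedBall_subset_closedBall (by gcongr))
    (Metric.closedBall_subset_closedBall (by gcongr))

theorem measurableSet_parabolicBox (R ρ : ℝ) (z : E n × ℝ) :
    MeasurableSet (parabolicBox R ρ z) :=
  measurableSet_closedBall.prod measurableSet_closedBall

theorem measurableSet_setOf_mem_parabolicBox (R ρ : ℝ) :
    MeasurableSet {x : (E n × ℝ) × (E n × ℝ) | x.2 ∈ parabolicBox R ρ x.1} :=
  ((isClosed_le (f := fun x : (E n × ℝ) × (E n × ℝ) => dist x.2.1 x.1.1) (by fun_prop)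
    continuous_const).inter (isClosed_le (f := fun x : (E n × ℝ) × (E n × ℝ) => dist x.2.2 x.1.2)
      (by fun_prop) continuous_const)).measurableSet

theorem parabolicDilation_inv_mem_closedBall_iff {R ρ : ℝ} (hρ : 0 < ρ) (v : E n × ℝ) :
    parabolicDilation ρ⁻¹ v ∈ Metric.closedBall 0 R ↔ v ∈ parabolicBox R ρ 0 := by
  simp [parabolicBox, parabolicDilation_apply, Prod.norm_def, norm_smul, abs_of_pos hρ,
    inv_mul_le_iff₀, hρ, mul_comm R]

theorem sub_mem_parabolicBox_zero_iff {R ρ : ℝ} {z w : E n × ℝ} :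
    w - z ∈ parabolicBox R ρ 0 ↔ w ∈ parabolicBox R ρ z := by
  simp [parabolicBox, dist_eq_norm]

theorem exists_volume_parabolicBox_le (n : ℕ) {R : ℝ} (hR : 0 ≤ R) :
    ∃ c : ℝ≥0, ∀ ρ : ℝ, 0 < ρ → ∀ z : E n × ℝ,
      volume (parabolicBox R ρ z) ≤ c * ENNReal.ofReal (ρ ^ (n + 2)) := by
  refine ⟨(R ^ n * (volume (Metric.ball (0 : E n) 1)).toReal * (2 * R)).toNNReal,
    fun ρ hρ z => le_of_eq ?_⟩
  rw [parabolicBox, Measure.volume_eq_prod, Measure.prod_prod, Real.volume_closedBall,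
    Measure.addHaar_closedBall _ _ (by positivity), finrank_euclideanSpace_fin,
    ← ENNReal.ofReal_toReal (measure_ball_lt_top (μ := (volume : Measure (E n)))).ne,
    ← ENNReal.ofReal_mul (by positivity), ← ENNReal.ofReal_mul (by positivity),
    ENNReal.toReal_ofReal ENNReal.toReal_nonneg]
  change _ = ENNReal.ofReal _ * _
  rw [← ENNReal.ofReal_mul (by positivity)]
  congr 1
  ring

/-- Smooth functions with compact support in `U`. -/
def IsTestIn (U : Set (E n × ℝ)) (ψ : E n × ℝ → ℝ) : Prop :=
  ContDiff ℝ ∞ ψ ∧ HasCompactSupport ψ ∧ tsupport ψ ⊆ U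

namespace IsTestIn

variable {U : Set (E n × ℝ)} {ψ : E n × ℝ → ℝ}

theorem fderiv_apply (h : IsTestIn U ψ) (v : E n × ℝ) : IsTestIn U fun y => fderiv ℝ ψ y v :=
  ⟨contDiff_iterDeriv [v] h.1, hasCompactSupport_iterDeriv [v] h.2.1,
    (tsupport_fderiv_apply_subset ℝ v).trans h.2.2⟩

theorem mul_left (h : IsTestIn U ψ) {a : E n × ℝ → ℝ} (ha : ContDiff ℝ ∞ a) :
    IsTestIn U fun y => a y * ψ y :=
  ⟨ha.mul h.1, h.2.1.mul_left, tsupport_mul_subset_right.trans h.2.2⟩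

theorem exists_enorm_le (h : IsTestIn U ψ) : ∃ B : ℝ≥0, ∀ y, ‖ψ y‖ₑ ≤ B := by
  obtain ⟨B, hB⟩ := h.1.continuous.bounded_above_of_compact_support h.2.1
  exact ⟨B.toNNReal, fun y => enorm_le_coe.2 (NNReal.le_toNNReal_of_coe_le (hB y))⟩

end IsTestIn

/-- The kernel `ψ` rescaled parabolically to scale `ρ` and centred at `z`, with the normalization
that preserves its integral. -/
noncomputable def rescaledKernel (ψ : E n × ℝ → ℝ) (z : E n × ℝ) (ρ : ℝ) (w : E n × ℝ) : ℝ :=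
  ρ⁻¹ ^ (n + 2) * ψ (parabolicDilation ρ⁻¹ (w - z))

variable {ψ : E n × ℝ → ℝ}

theorem contDiff_rescaledKernel (hψ : ContDiff ℝ ∞ ψ) (z : E n × ℝ) (ρ : ℝ) :
    ContDiff ℝ ∞ (rescaledKernel ψ z ρ) := by
  unfold rescaledKernel
  fun_prop

theorem fderiv_rescaledKernel_apply (hψ : ContDiff ℝ ∞ ψ) (z : E n × ℝ) (ρ : ℝ)
    (w v : E n × ℝ) :
    fderiv ℝ (rescaledKernel ψ z ρ) w v =
      rescaledKernel (fun y => fderiv ℝ ψ y (parabolicDilation ρ⁻¹ v)) z ρ w := by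
  have hdil : HasFDerivAt (fun w => parabolicDilation ρ⁻¹ (w - z))
      (parabolicDilation ρ⁻¹ : E n × ℝ →L[ℝ] E n × ℝ) w :=
    (parabolicDilation ρ⁻¹).hasFDerivAt.comp w ((hasFDerivAt_id w).sub_const z)
  have hψd := (hψ.differentiable (by simp) (parabolicDilation ρ⁻¹ (w - z))).hasFDerivAt
  exact congrArg (· v) ((hψd.comp w hdil).const_mul (ρ⁻¹ ^ (n + 2))).fderiv

theorem fderiv_rescaledKernel_dirX (hψ : ContDiff ℝ ∞ ψ) (z : E n × ℝ) (ρ : ℝ) (w : E n × ℝ)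
    (k : Fin n) :
    fderiv ℝ (rescaledKernel ψ z ρ) w (dirX k) =
      ρ⁻¹ * rescaledKernel (fun y => fderiv ℝ ψ y (dirX k)) z ρ w := by
  rw [fderiv_rescaledKernel_apply hψ, parabolicDilation_dirX]
  simp only [rescaledKernel, map_smul, smul_eq_mul]
  ring

theorem fderiv_rescaledKernel_dirT (hψ : ContDiff ℝ ∞ ψ) (z : E n × ℝ) (ρ : ℝ) (w : E n × ℝ) :
    fderiv ℝ (rescaledKernel ψ z ρ) w dirT =
      ρ⁻¹ ^ 2 * rescaledKernel (fun y => fderiv ℝ ψ y dirT) z ρ w := by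
  rw [fderiv_rescaledKernel_apply hψ, parabolicDilation_dirT]
  simp only [rescaledKernel, map_smul, smul_eq_mul]
  ring

theorem tsupport_rescaledKernel_subset (ψ : E n × ℝ → ℝ) (z : E n × ℝ) (ρ : ℝ) :
    tsupport (rescaledKernel ψ z ρ) ⊆ (fun w => parabolicDilation ρ⁻¹ (w - z)) ⁻¹' tsupport ψ :=
  tsupport_mul_subset_right.trans (tsupport_comp_subset_preimage ψ (by fun_prop))

theorem add_parabolicDilation_inv_sub {ρ : ℝ} (hρ : ρ ≠ 0) (z w : E n × ℝ) :
    z + parabolicDilation ρ (parabolicDilation ρ⁻¹ (w - z)) = w := by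
  rw [parabolicDilation_parabolicDilation_inv hρ, add_sub_cancel]

theorem hasCompactSupport_rescaledKernel (hψ : HasCompactSupport ψ) (z : E n × ℝ) {ρ : ℝ}
    (hρ : ρ ≠ 0) : HasCompactSupport (rescaledKernel ψ z ρ) :=
  (hψ.isCompact.image (f := fun y => z + parabolicDilation ρ y) (by fun_prop)).of_isClosed_subset
    (isClosed_tsupport _) fun w hw =>
      ⟨_, tsupport_rescaledKernel_subset ψ z ρ hw, add_parabolicDilation_inv_sub hρ z w⟩

theorem IsTestIn.isTest_rescaledKernel {U : Set (E n × ℝ)} (hψ : IsTestIn U ψ)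
    {Ω : Opens (E n)} {T : ℝ} {z : E n × ℝ} {ρ : ℝ} (hρ : ρ ≠ 0)
    (hz : ∀ y ∈ U, z + parabolicDilation ρ y ∈ (Ω : Set (E n)) ×ˢ Set.Ioo 0 T) :
    IsTest Ω T (rescaledKernel ψ z ρ) :=
  ⟨contDiff_rescaledKernel hψ.1 z ρ, hasCompactSupport_rescaledKernel hψ.2.1 z hρ, fun w hw =>
    add_parabolicDilation_inv_sub hρ z w ▸ hz _ (hψ.2.2 (tsupport_rescaledKernel_subset ψ z ρ hw))⟩

theorem enorm_rescaledKernel_le {R : ℝ} (hR : tsupport ψ ⊆ Metric.closedBall 0 R) {B : ℝ≥0}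
    (hB : ∀ y, ‖ψ y‖ₑ ≤ B) (z : E n × ℝ) {ρ : ℝ} (hρ : 0 < ρ) (w : E n × ℝ) :
    ‖rescaledKernel ψ z ρ w‖ₑ ≤
      (parabolicBox R ρ z).indicator (fun _ => B * ENNReal.ofReal (ρ⁻¹ ^ (n + 2))) w := by
  by_cases hw : parabolicDilation ρ⁻¹ (w - z) ∈ tsupport ψ
  · have hwbox : w ∈ parabolicBox R ρ z :=
      sub_mem_parabolicBox_zero_iff.1 ((parabolicDilation_inv_mem_closedBall_iff hρ _).1 (hR hw))
    rw [Set.indicator_of_mem hwbox, rescaledKernel, enorm_mul, mul_comm,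
      Real.enorm_of_nonneg (r := ρ⁻¹ ^ (n + 2)) (by positivity)]
    gcongr
    exact hB _
  · rw [rescaledKernel, image_eq_zero_of_notMem_tsupport hw, mul_zero, enorm_zero]
    exact zero_le

theorem lintegral_mul_enorm_rescaledKernel_le {R : ℝ} (hR : tsupport ψ ⊆ Metric.closedBall 0 R)
    {B : ℝ≥0} (hB : ∀ y, ‖ψ y‖ₑ ≤ B) (z : E n × ℝ) {ρ : ℝ} (hρ : 0 < ρ) (G : E n × ℝ → ℝ≥0∞)
    (μ : Measure (E n × ℝ)) :
    ∫⁻ w, G w * ‖rescaledKernel ψ z ρ w‖ₑ ∂μ ≤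
      B * ENNReal.ofReal (ρ⁻¹ ^ (n + 2)) * ∫⁻ w in parabolicBox R ρ z, G w ∂μ := by
  rw [← lintegral_const_mul' _ _ (by finiteness),
    ← lintegral_indicator (measurableSet_parabolicBox R ρ z)]
  refine lintegral_mono fun w => ?_
  refine (mul_le_mul_right (enorm_rescaledKernel_le hR hB z hρ w) _).trans_eq ?_
  by_cases hw : w ∈ parabolicBox R ρ z
  · simp only [Set.indicator_of_mem hw, mul_comm]
  · simp only [Set.indicator_of_notMem hw, mul_zero]

/-- The profile of the scale derivative of a rescaled kernel, see `hasDerivAt_rescaledKernel`. -/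
noncomputable def scaleDerivKernel (φ : E n × ℝ → ℝ) (y : E n × ℝ) : ℝ :=
  (n + 2) * φ y + fderiv ℝ φ y (y.1, 2 * y.2)

variable {φ : E n × ℝ → ℝ}

theorem hasDerivAt_pow_mul_comp_parabolicDilation (hφ : Differentiable ℝ φ) (v : E n × ℝ) (a : ℝ) :
    HasDerivAt (fun a : ℝ => a ^ (n + 2) * φ (parabolicDilation a v))
      (a ^ (n + 1) * scaleDerivKernel φ (parabolicDilation a v)) a := by
  have hdil : HasDerivAt (fun a : ℝ => parabolicDilation a v) (v.1, 2 * a * v.2) a := by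
    simp only [parabolicDilation_apply]
    refine HasDerivAt.prodMk ?_ ?_
    · simpa using (hasDerivAt_id a).smul_const v.1
    · simpa using (hasDerivAt_pow 2 a).mul_const v.2
  have hφdil := (hφ (parabolicDilation a v)).hasFDerivAt.comp_hasDerivAt a hdil
  have heuler : ((parabolicDilation a v).1, 2 * (parabolicDilation a v).2) =
      a • (v.1, 2 * a * v.2) := by
    simp only [parabolicDilation_apply, Prod.smul_mk, smul_eq_mul, Prod.mk.injEq, true_and]
    ring
  refine ((hasDerivAt_pow (n + 2) a).fun_mul hφdil).congr_deriv ?_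
  simp only [scaleDerivKernel, heuler, map_smul, smul_eq_mul, Function.comp, Nat.add_succ_sub_one]
  push_cast
  ring

theorem hasDerivAt_rescaledKernel (hφ : Differentiable ℝ φ) (z w : E n × ℝ) {ρ : ℝ}
    (hρ : ρ ≠ 0) :
    HasDerivAt (fun ρ => rescaledKernel φ z ρ w)
      (-(ρ⁻¹ * rescaledKernel (scaleDerivKernel φ) z ρ w)) ρ := by
  refine ((hasDerivAt_pow_mul_comp_parabolicDilation hφ (w - z) ρ⁻¹).comp ρ
    (hasDerivAt_inv hρ)).congr_deriv ?_
  rw [rescaledKernel]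
  ring

theorem scaleDerivKernel_eq_divergence (hφ : Differentiable ℝ φ) (y : E n × ℝ) :
    scaleDerivKernel φ y =
      (∑ k, fderiv ℝ (fun y : E n × ℝ => y.1 k * φ y) y (dirX k)) +
        2 * fderiv ℝ (fun y : E n × ℝ => y.2 * φ y) y dirT := by
  have hX : ∀ k : Fin n, fderiv ℝ (fun y : E n × ℝ => y.1 k * φ y) y (dirX k) =
      φ y + y.1 k * fderiv ℝ φ y (dirX k) := fun k => by
    have hcoord : HasFDerivAt (fun y : E n × ℝ => y.1 k)
        ((EuclideanSpace.proj k).comp (ContinuousLinearMap.fst ℝ (E n) ℝ)) y :=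
      ((EuclideanSpace.proj k).comp (ContinuousLinearMap.fst ℝ (E n) ℝ)).hasFDerivAt
    rw [(hcoord.fun_mul (hφ y).hasFDerivAt).fderiv]
    simp [dirX, add_comm]
  have hT : fderiv ℝ (fun y : E n × ℝ => y.2 * φ y) y dirT = φ y + y.2 * fderiv ℝ φ y dirT := by
    rw [(hasFDerivAt_snd.fun_mul (hφ y).hasFDerivAt).fderiv]
    simp [dirT, add_comm]
  have hy : (y.1, 2 * y.2) = (∑ k, y.1 k • dirX k) + (2 * y.2) • dirT := by
    ext k
    · simp [dirX, dirT, Prod.fst_sum, Pi.single_apply]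
    · simp [dirX, dirT, Prod.snd_sum]
  simp only [hX, hT, scaleDerivKernel, hy, map_add, map_sum, map_smul, smul_eq_mul,
    Finset.sum_add_distrib, Finset.sum_const, Finset.card_univ, Fintype.card_fin, nsmul_eq_mul]
  ring

theorem IsTestIn.scaleDerivKernel {U : Set (E n × ℝ)} (hφ : IsTestIn U φ) :
    IsTestIn U (scaleDerivKernel φ) := by
  have hsmooth : ContDiff ℝ ∞ fun y => fderiv ℝ φ y (y.1, 2 * y.2) :=
    (hφ.1.fderiv_right (m := ∞) (by simp)).clm_apply (by fun_prop)
  have hsupp : Function.support (ParabolicSobolev.scaleDerivKernel φ) ⊆ tsupport φ :=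
    fun y hy => by
      contrapose! hy
      have hfderiv : fderiv ℝ φ y = 0 :=
        image_eq_zero_of_notMem_tsupport fun h => hy (tsupport_fderiv_subset ℝ h)
      simp [ParabolicSobolev.scaleDerivKernel, hfderiv, image_eq_zero_of_notMem_tsupport hy]
  exact ⟨(contDiff_const.mul hφ.1).add hsmooth,
    hφ.2.1.mono' hsupp, (closure_minimal hsupp (isClosed_tsupport φ)).trans hφ.2.2⟩

end ParabolicScaling

section KernelAverages

variable {n : ℕ} {μ : Measure (E n × ℝ)} {U P : Set (E n × ℝ)} {φ f g : E n × ℝ → ℝ} {R : ℝ}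

/-- The average of `f` against the kernel `φ` rescaled to scale `ρ` and centred at `z`. -/
noncomputable def kernelAverage (μ : Measure (E n × ℝ)) (φ f : E n × ℝ → ℝ) (ρ : ℝ)
    (z : E n × ℝ) : ℝ :=
  ∫ w, f w * rescaledKernel φ z ρ w ∂μ

theorem stronglyMeasurable_kernelAverage [SFinite μ] (hφ : Continuous φ)
    (hf : StronglyMeasurable f) (ρ : ℝ) : StronglyMeasurable (kernelAverage μ φ f ρ) := by
  have hker : Continuous fun x : (E n × ℝ) × (E n × ℝ) => rescaledKernel φ x.1 ρ x.2 := by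
    unfold rescaledKernel
    fun_prop
  exact ((hf.comp_measurable measurable_snd).mul
    hker.stronglyMeasurable).integral_prod_right' (ν := μ)

theorem integrable_mul_rescaledKernel (hf : Integrable f μ) (hφ : IsTestIn U φ) (z : E n × ℝ)
    (ρ : ℝ) : Integrable (fun w => f w * rescaledKernel φ z ρ w) μ := by
  obtain ⟨B, hB⟩ := hφ.1.continuous.bounded_above_of_compact_support hφ.2.1
  refine hf.mul_bdd (c := |ρ⁻¹ ^ (n + 2)| * B)
    (contDiff_rescaledKernel hφ.1 z ρ).continuous.aestronglyMeasurable
    (Filter.Eventually.of_forall fun w => ?_)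
  rw [rescaledKernel, norm_mul, Real.norm_eq_abs (_ ^ _)]
  gcongr
  exact hB _

theorem kernelAverage_sub (hφ : IsTestIn U φ) (hf : Integrable f μ) (hg : Integrable g μ) (ρ : ℝ) :
    kernelAverage μ φ (f - g) ρ = kernelAverage μ φ f ρ - kernelAverage μ φ g ρ := by
  ext z
  simp only [kernelAverage, Pi.sub_apply, sub_mul]
  exact integral_sub (integrable_mul_rescaledKernel hf hφ z ρ)
    (integrable_mul_rescaledKernel hg hφ z ρ)

theorem enorm_kernelAverage_le (hR : tsupport φ ⊆ Metric.closedBall 0 R) {B : ℝ≥0}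
    (hB : ∀ y, ‖φ y‖ₑ ≤ B) (f : E n × ℝ → ℝ) {ρ : ℝ} (hρ : 0 < ρ) (z : E n × ℝ) :
    ‖kernelAverage μ φ f ρ z‖ₑ ≤
      B * ENNReal.ofReal (ρ⁻¹ ^ (n + 2)) * ∫⁻ w in parabolicBox R ρ z, ‖f w‖ₑ ∂μ :=
  (enorm_integral_le_lintegral_enorm _).trans <| by
    simpa only [enorm_mul] using lintegral_mul_enorm_rescaledKernel_le hR hB z hρ (‖f ·‖ₑ) μ

theorem hasDerivAt_kernelAverage (hf : Integrable f μ) (hφ : IsTestIn U φ) (z : E n × ℝ)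
    {ρ : ℝ} (hρ : 0 < ρ) :
    HasDerivAt (fun ρ => kernelAverage μ φ f ρ z)
      (-(ρ⁻¹ * kernelAverage μ (scaleDerivKernel φ) f ρ z)) ρ := by
  have hdiff := hφ.1.differentiable (by simp)
  obtain ⟨B, hB⟩ := hφ.scaleDerivKernel.1.continuous.bounded_above_of_compact_support
    hφ.scaleDerivKernel.2.1
  have hbound : ∀ w, ∀ x ∈ Set.Ioi (ρ / 2),
      ‖f w * -(x⁻¹ * rescaledKernel (scaleDerivKernel φ) z x w)‖ ≤
        ‖f w‖ * ((ρ / 2)⁻¹ * ((ρ / 2)⁻¹ ^ (n + 2) * B)) := fun w x hx => by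
    have hx0 : 0 < x⁻¹ := inv_pos.2 ((half_pos hρ).trans hx)
    have hxρ : x⁻¹ ≤ (ρ / 2)⁻¹ := inv_anti₀ (half_pos hρ) (le_of_lt hx)
    rw [norm_mul, norm_neg, norm_mul, rescaledKernel, norm_mul, Real.norm_of_nonneg hx0.le,
      Real.norm_of_nonneg (pow_nonneg hx0.le _)]
    gcongr
    exact hB _
  have hderiv := (hasDerivAt_integral_of_dominated_loc_of_deriv_le (μ := μ)
    (F := fun ρ w => f w * rescaledKernel φ z ρ w)
    (F' := fun ρ w => f w * -(ρ⁻¹ * rescaledKernel (scaleDerivKernel φ) z ρ w))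
    (Ioi_mem_nhds (half_lt_self hρ))
    (Filter.Eventually.of_forall fun ρ =>
      (integrable_mul_rescaledKernel hf hφ z ρ).aestronglyMeasurable)
    (integrable_mul_rescaledKernel hf hφ z ρ)
    (hf.aestronglyMeasurable.mul ((contDiff_const.mul
      (contDiff_rescaledKernel hφ.scaleDerivKernel.1 z ρ)).neg.continuous.aestronglyMeasurable))
    (Filter.Eventually.of_forall hbound) (hf.norm.mul_const _)
    (Filter.Eventually.of_forall fun w x hx =>
      (hasDerivAt_rescaledKernel hdiff z w ((half_pos hρ).trans hx).ne').const_mul (f w))).2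
  refine hderiv.congr_deriv ?_
  simp only [kernelAverage, ← integral_const_mul, ← integral_neg]
  exact integral_congr_ae (Filter.Eventually.of_forall fun w => by ring)

theorem det_parabolicDilation (a : ℝ) :
    LinearMap.det (parabolicDilation a : E n × ℝ →L[ℝ] E n × ℝ).toLinearMap = a ^ (n + 2) := by
  have hprod : (parabolicDilation a : E n × ℝ →L[ℝ] E n × ℝ).toLinearMap =
      (a • LinearMap.id).prodMap (a ^ 2 • LinearMap.id) := rfl
  rw [hprod, LinearMap.det_prodMap, LinearMap.det_smul, LinearMap.det_smul]
  simp [pow_add]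

theorem integral_rescaledKernel (hφ : Continuous φ) (z : E n × ℝ) {ρ : ℝ} (hρ : 0 < ρ) :
    ∫ w, rescaledKernel φ z ρ w = ∫ y, φ y := by
  have hρn : 0 < ρ⁻¹ ^ (n + 2) := by positivity
  have hhaar : (volume : Measure (E n × ℝ)).IsAddHaarMeasure :=
    Measure.prod.instIsAddHaarMeasure volume volume
  have hmap : Measure.map (parabolicDilation ρ⁻¹ : E n × ℝ → E n × ℝ) volume =
      ENNReal.ofReal (ρ⁻¹ ^ (n + 2))⁻¹ • volume := by
    have h := Measure.map_linearMap_addHaar_eq_smul_addHaar (volume : Measure (E n × ℝ))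
      ((det_parabolicDilation ρ⁻¹).trans_ne hρn.ne')
    rwa [det_parabolicDilation, abs_of_pos (inv_pos.2 hρn)] at h
  calc ∫ w, rescaledKernel φ z ρ w
      = ρ⁻¹ ^ (n + 2) * ∫ w, φ (parabolicDilation ρ⁻¹ w) := by
        rw [← integral_const_mul]
        exact integral_sub_right_eq_self (fun w => ρ⁻¹ ^ (n + 2) * φ (parabolicDilation ρ⁻¹ w)) z
    _ = ∫ y, φ y := by
        rw [← integral_map (parabolicDilation ρ⁻¹).continuous.aemeasurable
            hφ.aestronglyMeasurable, hmap, integral_smul_measure,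
          ENNReal.toReal_ofReal (inv_pos.2 hρn).le, smul_eq_mul, mul_inv_cancel_left₀ hρn.ne']

theorem ofReal_inv_pow_mul_ofReal_pow {ρ : ℝ} (hρ : 0 < ρ) (m : ℕ) :
    ENNReal.ofReal (ρ⁻¹ ^ m) * ENNReal.ofReal (ρ ^ m) = 1 := by
  rw [← ENNReal.ofReal_mul (by positivity), ← mul_pow, inv_mul_cancel₀ hρ.ne', one_pow,
    ENNReal.ofReal_one]

variable (hμ : μ ≤ volume) (hφ : IsTestIn U φ)
include hμ hφ

theorem exists_eLpNorm_one_kernelAverage_le [SFinite μ] :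
    ∃ C : ℝ≥0, ∀ f : E n × ℝ → ℝ, Measurable f → ∀ ρ : ℝ, 0 < ρ →
      eLpNorm (kernelAverage μ φ f ρ) 1 μ ≤ C * eLpNorm f 1 μ := by
  obtain ⟨R, hR0, hR⟩ := hφ.2.1.isCompact.isBounded.subset_closedBall_lt 0 0
  obtain ⟨B, hB⟩ := hφ.exists_enorm_le
  obtain ⟨c, hc⟩ := exists_volume_parabolicBox_le n hR0.le
  refine ⟨B * c, fun f hf ρ hρ => ?_⟩
  simp only [eLpNorm_one_eq_lintegral_enorm]
  calc ∫⁻ z, ‖kernelAverage μ φ f ρ z‖ₑ ∂μ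
      ≤ B * ENNReal.ofReal (ρ⁻¹ ^ (n + 2)) *
          ∫⁻ z, ∫⁻ w in parabolicBox R ρ z, ‖f w‖ₑ ∂μ ∂μ := by
        rw [← lintegral_const_mul' _ _ (by finiteness)]
        exact lintegral_mono fun z => enorm_kernelAverage_le hR hB f hρ z
    _ ≤ B * ENNReal.ofReal (ρ⁻¹ ^ (n + 2)) *
          (c * ENNReal.ofReal (ρ ^ (n + 2)) * ∫⁻ w, ‖f w‖ₑ ∂μ) := by
        gcongr
        exact lintegral_setLIntegral_le (measurableSet_setOf_mem_parabolicBox R ρ)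
          (fun _ _ => mem_parabolicBox_symm) (fun z => (hμ _).trans (hc ρ hρ z)) hf.enorm
    _ = (B * c : ℝ≥0) * (ENNReal.ofReal (ρ⁻¹ ^ (n + 2)) * ENNReal.ofReal (ρ ^ (n + 2))) *
          ∫⁻ w, ‖f w‖ₑ ∂μ := by
        push_cast
        ring
    _ = (B * c : ℝ≥0) * ∫⁻ w, ‖f w‖ₑ ∂μ := by
        rw [ofReal_inv_pow_mul_ofReal_pow hρ, mul_one]

variable [IsFiniteMeasure μ]

theorem exists_enorm_kernelAverage_sub_le (hR0 : 0 ≤ R)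
    (hR : tsupport φ ⊆ Metric.closedBall 0 R) :
    ∃ C : ℝ≥0, ∀ g : E n × ℝ → ℝ, Integrable g μ → ∀ (z : E n × ℝ) (ρ : ℝ), 0 < ρ →
      ∫ w, rescaledKernel φ z ρ w ∂μ = 1 → ∀ η : ℝ≥0∞,
      (∀ w ∈ parabolicBox R ρ z, ‖g w - g z‖ₑ ≤ η) →
      ‖kernelAverage μ φ g ρ z - g z‖ₑ ≤ C * η := by
  obtain ⟨B, hB⟩ := hφ.exists_enorm_le
  obtain ⟨c, hc⟩ := exists_volume_parabolicBox_le n hR0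
  refine ⟨B * c, fun g hg z ρ hρ hone η hη => ?_⟩
  have havg : kernelAverage μ φ g ρ z - g z = kernelAverage μ φ (g - fun _ => g z) ρ z := by
    rw [kernelAverage_sub hφ hg (integrable_const _), Pi.sub_apply]
    simp only [kernelAverage, integral_const_mul, hone, mul_one]
  calc ‖kernelAverage μ φ g ρ z - g z‖ₑ
      ≤ B * ENNReal.ofReal (ρ⁻¹ ^ (n + 2)) *
          ∫⁻ w in parabolicBox R ρ z, ‖g w - g z‖ₑ ∂μ :=
        havg ▸ enorm_kernelAverage_le hR hB _ hρ z
    _ ≤ B * ENNReal.ofReal (ρ⁻¹ ^ (n + 2)) * (η * (c * ENNReal.ofReal (ρ ^ (n + 2)))) := by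
        gcongr
        refine (setLIntegral_mono' (measurableSet_parabolicBox R ρ z) hη).trans ?_
        rw [setLIntegral_const]
        gcongr
        exact (hμ _).trans (hc ρ hρ z)
    _ = (B * c : ℝ≥0) * η * (ENNReal.ofReal (ρ⁻¹ ^ (n + 2)) * ENNReal.ofReal (ρ ^ (n + 2))) := by
        push_cast
        ring
    _ = (B * c : ℝ≥0) * η := by rw [ofReal_inv_pow_mul_ofReal_pow hρ, mul_one]

omit hμ hφ [IsFiniteMeasure μ] in
theorem eventually_dist_lt_of_mem_parabolicBox (n : ℕ) (R : ℝ) {δ : ℝ} (hδ : 0 < δ) :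
    ∀ᶠ ρ : ℝ in nhds 0, ∀ z w : E n × ℝ, w ∈ parabolicBox R ρ z → dist w z < δ := by
  have hspace : Filter.Tendsto (fun ρ : ℝ => R * ρ) (nhds 0) (nhds 0) :=
    Continuous.tendsto' (by fun_prop) _ _ (by simp)
  have htime : Filter.Tendsto (fun ρ : ℝ => R * ρ ^ 2) (nhds 0) (nhds 0) :=
    Continuous.tendsto' (by fun_prop) _ _ (by simp)
  filter_upwards [hspace.eventually_lt_const hδ, htime.eventually_lt_const hδ] with ρ h1 h2 z w hw
  exact max_lt (lt_of_le_of_lt hw.1 h1) (lt_of_le_of_lt hw.2 h2)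

variable (hone : ∀ᶠ ρ : ℝ in nhdsWithin 0 (Set.Ioi 0),
  ∀ z ∈ P, ∫ w, rescaledKernel φ z ρ w ∂μ = 1) (hP : MeasurableSet P)
include hone hP

theorem tendsto_eLpNorm_one_kernelAverage_sub_of_hasCompactSupport (hg : Continuous g)
    (hgc : HasCompactSupport g) :
    Filter.Tendsto (fun ρ => eLpNorm (kernelAverage μ φ g ρ - g) 1 (μ.restrict P))
      (nhdsWithin 0 (Set.Ioi 0)) (nhds 0) := by
  obtain ⟨R, hR0, hR⟩ := hφ.2.1.isCompact.isBounded.subset_closedBall_lt 0 0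
  obtain ⟨C, hC⟩ := exists_enorm_kernelAverage_sub_le hμ hφ hR0.le hR
  have hgi : Integrable g μ := hg.integrable_of_hasCompactSupport hgc
  refine ENNReal.tendsto_nhds_zero.2 fun ε hε => ?_
  obtain ⟨η, hη0, hη⟩ := ENNReal.exists_nnreal_pos_mul_lt (a := C * μ P) (by finiteness) hε.ne'
  obtain ⟨δ, hδ0, hδ⟩ := Metric.uniformContinuous_iff.1
    (hgc.uniformContinuous_of_continuous hg) η (NNReal.coe_pos.2 hη0)
  filter_upwards [hone, nhdsWithin_le_nhds (eventually_dist_lt_of_mem_parabolicBox n R hδ0),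
    self_mem_nhdsWithin] with ρ hone_ρ hbox hρ
  have hpoint : ∀ z ∈ P, ‖kernelAverage μ φ g ρ z - g z‖ₑ ≤ C * η := fun z hz =>
    hC g hgi z ρ hρ (hone_ρ z hz) η fun w hw => by
      rw [enorm_le_coe, ← NNReal.coe_le_coe, coe_nnnorm, ← dist_eq_norm]
      exact (hδ (hbox z w hw)).le
  calc eLpNorm (kernelAverage μ φ g ρ - g) 1 (μ.restrict P)
      ≤ C * η * μ P := by
        rw [eLpNorm_one_eq_lintegral_enorm, ← setLIntegral_const]
        exact setLIntegral_mono' hP hpoint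
    _ = η * (C * μ P) := by ring
    _ ≤ ε := hη.le

theorem tendsto_eLpNorm_one_kernelAverage_sub (hf : StronglyMeasurable f) (hfi : Integrable f μ) :
    Filter.Tendsto (fun ρ => eLpNorm (kernelAverage μ φ f ρ - f) 1 (μ.restrict P))
      (nhdsWithin 0 (Set.Ioi 0)) (nhds 0) := by
  obtain ⟨C, hC⟩ := exists_eLpNorm_one_kernelAverage_le hμ hφ
  refine ENNReal.tendsto_nhds_zero.2 fun ε hε => ?_
  obtain ⟨κ, hκ0, hκ⟩ := ENNReal.exists_nnreal_pos_mul_lt (a := C + 1) (b := ε / 2)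
    (by finiteness) (ENNReal.half_pos hε.ne').ne'
  obtain ⟨g, hgc, hfg, hg, hgi⟩ :=
    (memLp_one_iff_integrable.2 hfi).exists_hasCompactSupport_eLpNorm_sub_le
      ENNReal.one_ne_top (ENNReal.coe_ne_zero.2 hκ0.ne')
  filter_upwards [self_mem_nhdsWithin, ENNReal.tendsto_nhds_zero.1
    (tendsto_eLpNorm_one_kernelAverage_sub_of_hasCompactSupport hμ hφ hone hP hg hgc) (ε / 2)
    (ENNReal.half_pos hε.ne')] with ρ hρ hgρ
  have hfg_meas : StronglyMeasurable (f - g) := hf.sub hg.stronglyMeasurable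
  have hA : ∀ {k : E n × ℝ → ℝ}, StronglyMeasurable k →
      AEStronglyMeasurable (kernelAverage μ φ k ρ) (μ.restrict P) := fun hk =>
    (stronglyMeasurable_kernelAverage hφ.1.continuous hk ρ).aestronglyMeasurable
  have hsplit : kernelAverage μ φ f ρ - f =
      (kernelAverage μ φ (f - g) ρ - (f - g)) + (kernelAverage μ φ g ρ - g) := by
    rw [kernelAverage_sub hφ hfi (memLp_one_iff_integrable.1 hgi)]
    abel
  calc eLpNorm (kernelAverage μ φ f ρ - f) 1 (μ.restrict P)
      ≤ eLpNorm (kernelAverage μ φ (f - g) ρ - (f - g)) 1 (μ.restrict P) +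
          eLpNorm (kernelAverage μ φ g ρ - g) 1 (μ.restrict P) := by
        rw [hsplit]
        exact eLpNorm_add_le ((hA hfg_meas).sub hfg_meas.aestronglyMeasurable)
          ((hA hg.stronglyMeasurable).sub hg.aestronglyMeasurable) le_rfl
    _ ≤ eLpNorm (kernelAverage μ φ (f - g) ρ) 1 μ + eLpNorm (f - g) 1 μ + ε / 2 := by
        gcongr
        exact (eLpNorm_sub_le (hA hfg_meas) hfg_meas.aestronglyMeasurable le_rfl).trans
          (add_le_add (eLpNorm_mono_measure _ Measure.restrict_le_self)
            (eLpNorm_mono_measure _ Measure.restrict_le_self))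
    _ ≤ C * κ + κ + ε / 2 := by
        gcongr
        exact (hC _ hfg_meas.measurable ρ hρ).trans (by gcongr)
    _ = κ * (C + 1) + ε / 2 := by ring
    _ ≤ ε := (add_le_add_left hκ.le _).trans_eq (ENNReal.add_halves ε)

end KernelAverages

section ParabolicControl

variable {n : ℕ} {Ω : Opens (E n)} {T : ℝ}

/-- `G` controls the first order distributional derivatives of `f` on the open cylinder. The time
derivative may be the sum of a function and of spatial derivatives of functions, all bounded by
`G`: for a spatial derivative `u_{x_l}` of `u ∈ W^{2,1}_p`, it is `(u_t)_{x_l}`. -/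
def HasParabolicControl (Ω : Opens (E n)) (T : ℝ) (f : E n × ℝ → ℝ) (G : E n × ℝ → ℝ≥0∞) : Prop :=
  ∀ ψ : E n × ℝ → ℝ, IsTest Ω T ψ →
    (∀ k, ‖∫ w, f w * fderiv ℝ ψ w (dirX k) ∂(cylMeasure Ω T)‖ₑ ≤
      ∫⁻ w, G w * ‖ψ w‖ₑ ∂(cylMeasure Ω T)) ∧
    ‖∫ w, f w * fderiv ℝ ψ w dirT ∂(cylMeasure Ω T)‖ₑ ≤
      ∫⁻ w, G w * ‖ψ w‖ₑ ∂(cylMeasure Ω T) +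
        ∑ l, ∫⁻ w, G w * ‖fderiv ℝ ψ w (dirX l)‖ₑ ∂(cylMeasure Ω T)

/-- At every point of `P`, the parabolic dilates of `U` of scale at most `h` lie in the open
cylinder, so that kernels supported in `U` become test functions when rescaled at points of `P`. -/
def IsPatch (Ω : Opens (E n)) (T : ℝ) (P U : Set (E n × ℝ)) (h : ℝ) : Prop :=
  ∀ z ∈ P, ∀ ρ : ℝ, 0 < ρ → ρ ≤ h →
    ∀ y ∈ U, z + parabolicDilation ρ y ∈ (Ω : Set (E n)) ×ˢ Set.Ioo 0 T

/-- The derivative in `ρ` of the averages of `f` at points of `P` is bounded by local integrals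
of `G`, up to scale `h`; see `hasDerivAt_kernelAverage`. -/
def HasScaleDerivBound (μ : Measure (E n × ℝ)) (φ : E n × ℝ → ℝ) (P : Set (E n × ℝ)) (R h : ℝ)
    (C : ℝ≥0) (f : E n × ℝ → ℝ) (G : E n × ℝ → ℝ≥0∞) : Prop :=
  ∀ z ∈ P, ∀ ρ : ℝ, 0 < ρ → ρ ≤ h → ‖kernelAverage μ (scaleDerivKernel φ) f ρ z‖ₑ ≤
    C * ENNReal.ofReal (ρ⁻¹ ^ (n + 1)) * ∫⁻ w in parabolicBox R ρ z, G w ∂μ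

theorem ofReal_mul_ofReal_inv_pow_succ {ρ : ℝ} (hρ : 0 < ρ) (m : ℕ) :
    ENNReal.ofReal ρ * ENNReal.ofReal (ρ⁻¹ ^ (m + 1)) = ENNReal.ofReal (ρ⁻¹ ^ m) := by
  rw [← ENNReal.ofReal_mul hρ.le, pow_succ', mul_inv_cancel_left₀ hρ.ne']

variable {U : Set (E n × ℝ)} {φ ψ f : E n × ℝ → ℝ} {G : E n × ℝ → ℝ≥0∞} {R : ℝ}

theorem ofReal_mul_lintegral_mul_enorm_rescaledKernel_le {μ : Measure (E n × ℝ)}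
    (hR : tsupport ψ ⊆ Metric.closedBall 0 R) {B : ℝ≥0} (hB : ∀ y, ‖ψ y‖ₑ ≤ B) (z : E n × ℝ)
    {ρ : ℝ} (hρ : 0 < ρ) :
    ENNReal.ofReal ρ * ∫⁻ w, G w * ‖rescaledKernel ψ z ρ w‖ₑ ∂μ ≤
      B * ENNReal.ofReal (ρ⁻¹ ^ (n + 1)) * ∫⁻ w in parabolicBox R ρ z, G w ∂μ := by
  rw [← ofReal_mul_ofReal_inv_pow_succ hρ (n + 1), mul_left_comm (B : ℝ≥0∞), mul_assoc]
  gcongr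
  exact lintegral_mul_enorm_rescaledKernel_le hR hB z hρ G μ

theorem HasParabolicControl.exists_enorm_kernelAverage_fderiv_dirX_le
    (hψ : IsTestIn U ψ) (hR : U ⊆ Metric.closedBall 0 R) (k : Fin n) :
    ∃ C : ℝ≥0, ∀ (f : E n × ℝ → ℝ) (G : E n × ℝ → ℝ≥0∞), HasParabolicControl Ω T f G →
      ∀ (z : E n × ℝ) (ρ : ℝ), 0 < ρ →
      (∀ y ∈ U, z + parabolicDilation ρ y ∈ (Ω : Set (E n)) ×ˢ Set.Ioo 0 T) →
      ‖kernelAverage (cylMeasure Ω T) (fun y => fderiv ℝ ψ y (dirX k)) f ρ z‖ₑ ≤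
        C * ENNReal.ofReal (ρ⁻¹ ^ (n + 1)) *
          ∫⁻ w in parabolicBox R ρ z, G w ∂(cylMeasure Ω T) := by
  obtain ⟨B, hB⟩ := hψ.exists_enorm_le
  refine ⟨B, fun f G hfG z ρ hρ hz => ?_⟩
  have hkernel : kernelAverage (cylMeasure Ω T) (fun y => fderiv ℝ ψ y (dirX k)) f ρ z =
      ρ * ∫ w, f w * fderiv ℝ (rescaledKernel ψ z ρ) w (dirX k) ∂(cylMeasure Ω T) := by
    rw [kernelAverage, ← integral_const_mul]
    refine integral_congr_ae (Filter.Eventually.of_forall fun w => ?_)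
    simp only [fderiv_rescaledKernel_dirX hψ.1]
    field_simp
  rw [hkernel, enorm_mul, Real.enorm_of_nonneg hρ.le]
  exact (mul_le_mul_right ((hfG _ (hψ.isTest_rescaledKernel hρ.ne' hz)).1 k) _).trans
    (ofReal_mul_lintegral_mul_enorm_rescaledKernel_le (hψ.2.2.trans hR) hB z hρ)

theorem HasParabolicControl.exists_enorm_kernelAverage_fderiv_dirT_le
    (hψ : IsTestIn U ψ) (hR : U ⊆ Metric.closedBall 0 R) :
    ∃ C : ℝ≥0, ∀ (f : E n × ℝ → ℝ) (G : E n × ℝ → ℝ≥0∞), HasParabolicControl Ω T f G →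
      ∀ (z : E n × ℝ) (ρ : ℝ), 0 < ρ → ρ ≤ 1 →
      (∀ y ∈ U, z + parabolicDilation ρ y ∈ (Ω : Set (E n)) ×ˢ Set.Ioo 0 T) →
      ‖kernelAverage (cylMeasure Ω T) (fun y => fderiv ℝ ψ y dirT) f ρ z‖ₑ ≤
        C * ENNReal.ofReal (ρ⁻¹ ^ (n + 1)) *
          ∫⁻ w in parabolicBox R ρ z, G w ∂(cylMeasure Ω T) := by
  have hψl := fun l : Fin n => hψ.fderiv_apply (dirX l)
  obtain ⟨B, hB⟩ := hψ.exists_enorm_le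
  choose Bl hBl using fun l => (hψl l).exists_enorm_le
  refine ⟨B + ∑ l, Bl l, fun f G hfG z ρ hρ hρ1 hz => ?_⟩
  have hkernel : kernelAverage (cylMeasure Ω T) (fun y => fderiv ℝ ψ y dirT) f ρ z =
      ρ ^ 2 * ∫ w, f w * fderiv ℝ (rescaledKernel ψ z ρ) w dirT ∂(cylMeasure Ω T) := by
    rw [kernelAverage, ← integral_const_mul]
    refine integral_congr_ae (Filter.Eventually.of_forall fun w => ?_)
    simp only [fderiv_rescaledKernel_dirT hψ.1]
    field_simp
  have hspatial : ∀ l, ENNReal.ofReal (ρ ^ 2) *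
      ∫⁻ w, G w * ‖fderiv ℝ (rescaledKernel ψ z ρ) w (dirX l)‖ₑ ∂(cylMeasure Ω T) =
      ENNReal.ofReal ρ * ∫⁻ w, G w *
        ‖rescaledKernel (fun y => fderiv ℝ ψ y (dirX l)) z ρ w‖ₑ ∂(cylMeasure Ω T) := fun l => by
    rw [← lintegral_const_mul' _ _ (by finiteness), ← lintegral_const_mul' _ _ (by finiteness)]
    refine lintegral_congr fun w => ?_
    rw [fderiv_rescaledKernel_dirX hψ.1, enorm_mul, Real.enorm_of_nonneg (inv_pos.2 hρ).le,
      mul_left_comm (G w), ← mul_assoc, ← ENNReal.ofReal_mul (by positivity)]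
    congr 2
    field_simp
  rw [hkernel, enorm_mul, Real.enorm_of_nonneg (sq_nonneg ρ)]
  refine (mul_le_mul_right (hfG _ (hψ.isTest_rescaledKernel hρ.ne' hz)).2 _).trans ?_
  rw [mul_add, Finset.mul_sum]
  simp only [hspatial]
  push_cast
  rw [add_mul, add_mul, Finset.sum_mul, Finset.sum_mul]
  refine add_le_add ?_ (Finset.sum_le_sum fun l _ =>
    ofReal_mul_lintegral_mul_enorm_rescaledKernel_le ((hψl l).2.2.trans hR) (hBl l) z hρ)
  refine le_trans ?_
    (ofReal_mul_lintegral_mul_enorm_rescaledKernel_le (hψ.2.2.trans hR) hB z hρ)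
  gcongr
  exact pow_le_of_le_one hρ.le hρ1 two_ne_zero

theorem kernelAverage_scaleDerivKernel {μ : Measure (E n × ℝ)} (hf : Integrable f μ)
    (hφ : IsTestIn U φ) (ρ : ℝ) (z : E n × ℝ) :
    kernelAverage μ (scaleDerivKernel φ) f ρ z =
      (∑ k, kernelAverage μ
        (fun y => fderiv ℝ (fun y : E n × ℝ => y.1 k * φ y) y (dirX k)) f ρ z) +
      2 * kernelAverage μ (fun y => fderiv ℝ (fun y : E n × ℝ => y.2 * φ y) y dirT) f ρ z := by
  have hX := fun k : Fin n => integrable_mul_rescaledKernel hf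
    ((hφ.mul_left (a := fun y => y.1 k) (by fun_prop)).fderiv_apply (dirX k)) z ρ
  have hT := integrable_mul_rescaledKernel hf
    ((hφ.mul_left (a := fun y => y.2) (by fun_prop)).fderiv_apply dirT) z ρ
  simp only [kernelAverage]
  rw [← integral_finsetSum _ fun k _ => hX k, ← integral_const_mul,
    ← integral_add (integrable_finsetSum _ fun k _ => hX k) (hT.const_mul 2)]
  refine integral_congr_ae (Filter.Eventually.of_forall fun w => ?_)
  simp only [rescaledKernel, scaleDerivKernel_eq_divergence (hφ.1.differentiable (by simp)),
    ← Finset.mul_sum]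
  ring

theorem IsPatch.exists_hasScaleDerivBound {P : Set (E n × ℝ)} {h : ℝ} (hP : IsPatch Ω T P U h)
    (h1 : h ≤ 1) (hφ : IsTestIn U φ) (hR : U ⊆ Metric.closedBall 0 R) :
    ∃ C : ℝ≥0, ∀ (f : E n × ℝ → ℝ) (G : E n × ℝ → ℝ≥0∞), Integrable f (cylMeasure Ω T) →
      HasParabolicControl Ω T f G → HasScaleDerivBound (cylMeasure Ω T) φ P R h C f G := by
  have hX : ∀ k : Fin n, IsTestIn U fun y : E n × ℝ => y.1 k * φ y := fun k =>
    hφ.mul_left (a := fun y => y.1 k) (by fun_prop)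
  have hT : IsTestIn U fun y : E n × ℝ => y.2 * φ y :=
    hφ.mul_left (a := fun y => y.2) (by fun_prop)
  choose CX hCX using fun k =>
    HasParabolicControl.exists_enorm_kernelAverage_fderiv_dirX_le (Ω := Ω) (T := T) (hX k) hR k
  obtain ⟨CT, hCT⟩ :=
    HasParabolicControl.exists_enorm_kernelAverage_fderiv_dirT_le (Ω := Ω) (T := T) hT hR
  refine ⟨(∑ k, CX k) + 2 * CT, fun f G hf hfG z hz ρ hρ hρh => ?_⟩
  have hzU := hP z hz ρ hρ hρh
  rw [kernelAverage_scaleDerivKernel hf hφ]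
  refine (enorm_add_le _ _).trans ?_
  push_cast
  rw [add_mul, add_mul, Finset.sum_mul, Finset.sum_mul, enorm_mul, mul_assoc 2, mul_assoc 2,
    Real.enorm_of_nonneg zero_le_two, ENNReal.ofReal_ofNat]
  refine add_le_add ((enorm_sum_le _ _).trans (Finset.sum_le_sum fun k _ => ?_))
    (mul_le_mul_right ?_ _)
  · exact hCX k f G hfG z ρ hρ hzU
  · exact hCT f G hfG z ρ hρ (hρh.trans h1) hzU

end ParabolicControl

section DerivativesOfW21

variable {n : ℕ} {Ω : Opens (E n)} {T : ℝ} {p : ℝ≥0∞} [Fact (1 ≤ p)] {ζ : E n × ℝ → ℝ}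

theorem fderiv_fderiv_apply_comm (h : ContDiff ℝ ∞ ζ) (z v w : E n × ℝ) :
    fderiv ℝ (fun y => fderiv ℝ ζ y w) z v = fderiv ℝ (fun y => fderiv ℝ ζ y v) z w := by
  have hdiff : DifferentiableAt ℝ (fderiv ℝ ζ) z :=
    (h.fderiv_right (m := ∞) (by simp)).differentiable (by simp) z
  have hsymm : IsSymmSndFDerivAt ℝ ζ z := h.contDiffAt.isSymmSndFDerivAt
    (by rw [minSmoothness_of_isRCLikeNormedField]; exact WithTop.coe_le_coe.2 le_top)
  rw [fderiv_clm_apply hdiff (differentiableAt_const w),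
    fderiv_clm_apply hdiff (differentiableAt_const v)]
  simpa using hsymm v w

/-- The sum of the moduli of the weak derivatives which enter the norm of `W^{2,1}_p`. -/
noncomputable def derivSum (u : W21 Ω T p) (w : E n × ℝ) : ℝ≥0∞ := ∑ i, ‖u.wderiv i w‖ₑ

theorem measurable_derivSum (u : W21 Ω T p) : Measurable (derivSum u) :=
  Finset.measurable_sum _ fun i _ => (Lp.stronglyMeasurable (u.wderiv i)).measurable.enorm

theorem eLpNorm_derivSum_le (u : W21 Ω T p) :
    eLpNorm (derivSum u) p (cylMeasure Ω T) ≤ ‖u‖ₑ := by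
  have hsum : derivSum u = ∑ i, fun w => ‖u.wderiv i w‖ₑ := by
    ext w
    simp [derivSum]
  calc eLpNorm (derivSum u) p (cylMeasure Ω T)
      ≤ ∑ i, eLpNorm (fun w => ‖u.wderiv i w‖ₑ) p (cylMeasure Ω T) := by
        rw [hsum]
        exact eLpNorm_sum_le (fun i _ => (Lp.stronglyMeasurable
          (u.wderiv i)).measurable.enorm.aestronglyMeasurable) Fact.out
    _ = ENNReal.ofReal (∑ i, ‖u.wderiv i‖) := by
        rw [ENNReal.ofReal_sum_of_nonneg fun i _ => norm_nonneg _]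
        simp only [eLpNorm_enorm, ofReal_norm, Lp.enorm_def]
    _ ≤ ‖u‖ₑ := by
        rw [← ofReal_norm u, Sobolev.norm_eq u]
        exact ENNReal.ofReal_le_ofReal (le_add_of_nonneg_left (norm_nonneg _))

theorem enorm_integral_wderiv_mul_le (u : W21 Ω T p) (i : Unit ⊕ Fin n ⊕ (Fin n × Fin n))
    (ζ : E n × ℝ → ℝ) :
    ‖∫ w, u.wderiv i w * ζ w ∂(cylMeasure Ω T)‖ₑ ≤
      ∫⁻ w, derivSum u w * ‖ζ w‖ₑ ∂(cylMeasure Ω T) := by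
  refine (enorm_integral_le_lintegral_enorm _).trans (lintegral_mono fun w => ?_)
  rw [enorm_mul]
  gcongr
  exact Finset.single_le_sum (f := fun i => ‖u.wderiv i w‖ₑ) (fun _ _ => zero_le)
    (Finset.mem_univ i)

theorem integral_toLp_mul_fderiv_dirX (u : W21 Ω T p) (hζ : IsTest Ω T ζ) (k : Fin n) :
    ∫ w, u.toLp w * fderiv ℝ ζ w (dirX k) ∂(cylMeasure Ω T) =
      -∫ w, u.wderiv (Sum.inr (Sum.inl k)) w * ζ w ∂(cylMeasure Ω T) := by
  simpa [derivs21, iterDeriv] using u.hasWeakDeriv (Sum.inr (Sum.inl k)) ζ hζ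

theorem integral_toLp_mul_fderiv_dirT (u : W21 Ω T p) (hζ : IsTest Ω T ζ) :
    ∫ w, u.toLp w * fderiv ℝ ζ w dirT ∂(cylMeasure Ω T) =
      -∫ w, u.wderiv (Sum.inl ()) w * ζ w ∂(cylMeasure Ω T) := by
  simpa [derivs21, iterDeriv] using u.hasWeakDeriv (Sum.inl ()) ζ hζ

theorem integral_wderiv_mul_fderiv_dirX (u : W21 Ω T p) (hζ : IsTest Ω T ζ) (k l : Fin n) :
    ∫ w, u.wderiv (Sum.inr (Sum.inl l)) w * fderiv ℝ ζ w (dirX k) ∂(cylMeasure Ω T) =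
      -∫ w, u.wderiv (Sum.inr (Sum.inr (k, l))) w * ζ w ∂(cylMeasure Ω T) := by
  have hsecond : ∫ w, u.toLp w * fderiv ℝ (fun y => fderiv ℝ ζ y (dirX k)) w (dirX l)
      ∂(cylMeasure Ω T) =
      ∫ w, u.wderiv (Sum.inr (Sum.inr (k, l))) w * ζ w ∂(cylMeasure Ω T) := by
    simpa [derivs21, iterDeriv] using u.hasWeakDeriv (Sum.inr (Sum.inr (k, l))) ζ hζ
  rw [← hsecond, integral_toLp_mul_fderiv_dirX u (IsTestIn.fderiv_apply hζ (dirX k)) l, neg_neg]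

theorem integral_wderiv_mul_fderiv_dirT (u : W21 Ω T p) (hζ : IsTest Ω T ζ) (l : Fin n) :
    ∫ w, u.wderiv (Sum.inr (Sum.inl l)) w * fderiv ℝ ζ w dirT ∂(cylMeasure Ω T) =
      ∫ w, u.wderiv (Sum.inl ()) w * fderiv ℝ ζ w (dirX l) ∂(cylMeasure Ω T) := by
  have hX := integral_toLp_mul_fderiv_dirX u (IsTestIn.fderiv_apply hζ dirT) l
  have hT := integral_toLp_mul_fderiv_dirT u (IsTestIn.fderiv_apply hζ (dirX l))
  simp only [fderiv_fderiv_apply_comm hζ.1 _ (dirX l) dirT] at hX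
  linarith

theorem hasParabolicControl_toLp (u : W21 Ω T p) :
    HasParabolicControl Ω T u.toLp (derivSum u) := fun ζ hζ => by
  refine ⟨fun k => ?_, le_add_right ?_⟩
  · rw [integral_toLp_mul_fderiv_dirX u hζ, enorm_neg]
    exact enorm_integral_wderiv_mul_le u _ ζ
  · rw [integral_toLp_mul_fderiv_dirT u hζ, enorm_neg]
    exact enorm_integral_wderiv_mul_le u _ ζ

theorem hasParabolicControl_wderiv (u : W21 Ω T p) (l : Fin n) :
    HasParabolicControl Ω T (u.wderiv (Sum.inr (Sum.inl l))) (derivSum u) := fun ζ hζ => by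
  refine ⟨fun k => ?_, le_add_left ?_⟩
  · rw [integral_wderiv_mul_fderiv_dirX u hζ, enorm_neg]
    exact enorm_integral_wderiv_mul_le u _ ζ
  · rw [integral_wderiv_mul_fderiv_dirT u hζ]
    exact (enorm_integral_wderiv_mul_le u _ _).trans (Finset.single_le_sum
      (f := fun l => ∫⁻ w, derivSum u w * ‖fderiv ℝ ζ w (dirX l)‖ₑ ∂(cylMeasure Ω T))
      (fun _ _ => zero_le) (Finset.mem_univ l))

end DerivativesOfW21

section InteriorCones

variable {n : ℕ}

/-- Near `x₀`, truncated translates of one open cone with vertex at a point of `Ω` stay in `Ω`. The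
cone is generated by the ball of radius `ε` about `e`, and is the whole space if `‖e‖ < ε`. -/
def HasInteriorConeAt (Ω : Set (E n)) (x₀ : E n) : Prop :=
  ∃ (e : E n) (ε r : ℝ), 0 < ε ∧ 0 < r ∧ ∀ x ∈ Metric.ball x₀ r ∩ Ω, ∀ τ ∈ Set.Ioc 0 r,
    ∀ y ∈ Metric.ball e ε, x + τ • y ∈ Ω

/-- The uniform interior cone condition, in local form. -/
def HasInteriorCones (Ω : Set (E n)) : Prop :=
  ∀ x₀ ∈ closure Ω, HasInteriorConeAt Ω x₀

variable {Ω : Set (E n)} {x₀ e x y : E n} {τ : ℝ}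

theorem add_smul_mem_ball {r s t : ℝ} (hx : x ∈ Metric.ball x₀ r) (hτ : τ ∈ Set.Ioc 0 t)
    (hy : ‖y‖ ≤ s) : x + τ • y ∈ Metric.ball x₀ (r + t * s) := by
  rw [mem_ball_iff_norm] at hx ⊢
  calc ‖x + τ • y - x₀‖ = ‖(x - x₀) + τ • y‖ := by rw [add_sub_right_comm]
    _ ≤ ‖x - x₀‖ + τ * ‖y‖ := by
      simpa only [norm_smul_of_nonneg hτ.1.le] using norm_add_le (x - x₀) (τ • y)
    _ < r + t * s :=
      add_lt_add_of_lt_of_le hx (mul_le_mul hτ.2 hy (norm_nonneg y) (hτ.1.le.trans hτ.2))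

theorem hasInteriorConeAt_of_mem_nhds (hΩ : Ω ∈ nhds x₀) : HasInteriorConeAt Ω x₀ := by
  obtain ⟨δ, hδ, hball⟩ := Metric.mem_nhds_iff.1 hΩ
  refine ⟨0, 1, δ / 2, one_pos, half_pos hδ, fun x hx τ hτ y hy => hball ?_⟩
  simpa using add_smul_mem_ball hx.1 hτ (mem_ball_zero_iff.1 hy).le

theorem epigraph_add_smul_of_lipschitzWith {γ : E n → ℝ} {K : ℝ≥0} (hγ : LipschitzWith K γ)
    (he : ‖e‖ = 1) (hx : γ (x - inner ℝ e x • e) < inner ℝ e x) (hτ : 0 < τ)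
    (hy : y ∈ Metric.ball e (1 / (2 * K + 1))) :
    γ (x + τ • y - inner ℝ e (x + τ • y) • e) < inner ℝ e (x + τ • y) := by
  obtain ⟨v, rfl⟩ : ∃ v, y = e + v := ⟨y - e, (add_sub_cancel e y).symm⟩
  have hv : ‖v‖ * (2 * K + 1) < 1 := by
    rwa [mem_ball_iff_norm, add_sub_cancel_left, lt_div_iff₀ (by positivity)] at hy
  have hvert : inner ℝ e (x + τ • (e + v)) = inner ℝ e x + τ * (1 + inner ℝ e v) := by
    rw [inner_add_right, inner_smul_right, inner_add_right, real_inner_self_eq_norm_sq, he, one_pow]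
  have hinner : |inner ℝ e v| ≤ ‖v‖ := by simpa [he] using abs_real_inner_le_norm e v
  have hproj : ‖v - inner ℝ e v • e‖ ≤ 2 * ‖v‖ := by
    refine (norm_sub_le _ _).trans ?_
    rw [norm_smul, he, Real.norm_eq_abs]
    linarith
  have hdiff : x + τ • (e + v) - inner ℝ e (x + τ • (e + v)) • e - (x - inner ℝ e x • e) =
      τ • (v - inner ℝ e v • e) := by
    rw [hvert]
    module
  have hgraph : γ (x + τ • (e + v) - inner ℝ e (x + τ • (e + v)) • e) ≤
      γ (x - inner ℝ e x • e) + K * (τ * (2 * ‖v‖)) := by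
    have hlip := (Real.le_norm_self _).trans (hγ.norm_sub_le
      (x + τ • (e + v) - inner ℝ e (x + τ • (e + v)) • e) (x - inner ℝ e x • e))
    rw [hdiff, norm_smul_of_nonneg hτ.le, sub_le_iff_le_add'] at hlip
    exact hlip.trans (by gcongr)
  calc γ (x + τ • (e + v) - inner ℝ e (x + τ • (e + v)) • e)
      < inner ℝ e x + K * (τ * (2 * ‖v‖)) := by linarith
    _ ≤ inner ℝ e x + τ * (1 + inner ℝ e v) := by
      nlinarith [mul_le_mul_of_nonneg_left (neg_le_of_abs_le hinner) hτ.le]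
    _ = inner ℝ e (x + τ • (e + v)) := hvert.symm

theorem HasLipschitzBoundary.hasInteriorCones (hΩ : HasLipschitzBoundary Ω) :
    HasInteriorCones Ω := by
  intro x₀ hx₀
  by_cases hint : x₀ ∈ interior Ω
  · exact hasInteriorConeAt_of_mem_nhds (mem_interior_iff_mem_nhds.1 hint)
  obtain ⟨e, γ, K, ρ, he, hγ, hρ, hepi⟩ := hΩ x₀ ⟨hx₀, hint⟩
  refine ⟨e, 1 / (2 * K + 1), ρ / 4, by positivity, by positivity, fun x hx τ hτ y hy => ?_⟩
  have hynorm : ‖y‖ ≤ 2 := by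
    have hε : 1 / (2 * (K : ℝ) + 1) ≤ 1 := div_le_one_of_le₀ (by simp) (by positivity)
    linarith [norm_le_norm_add_norm_sub' y e, mem_ball_iff_norm.1 hy]
  have hxρ : x ∈ Metric.ball x₀ ρ := Metric.ball_subset_ball (by linarith) hx.1
  have hyρ : x + τ • y ∈ Metric.ball x₀ ρ :=
    Metric.ball_subset_ball (by linarith) (add_smul_mem_ball hx.1 hτ hynorm)
  exact (hepi _ hyρ).2 (epigraph_add_smul_of_lipschitzWith hγ he ((hepi x hxρ).1 hx.2) hτ.1 hy)

/-- The cone points into the future in the first half of the cylinder and into the past in the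
second half, so that it leaves the cylinder neither at `t = 0` nor at `t = T`. -/
theorem HasInteriorConeAt.exists_isPatch {Ω : Opens (E n)} (hΩ : HasInteriorConeAt Ω x₀) {T : ℝ}
    (hT : 0 < T) :
    ∃ (e : E n) (ε r h : ℝ), 0 < ε ∧ 0 < r ∧ 0 < h ∧ h ≤ 1 ∧
      IsPatch Ω T ((Metric.ball x₀ r ∩ Ω) ×ˢ Set.Ioc 0 (T / 2)) (Metric.ball (e, 1) ε) h ∧
      IsPatch Ω T ((Metric.ball x₀ r ∩ Ω) ×ˢ Set.Ioc (T / 2) T) (Metric.ball (e, -1) ε) h := by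
  obtain ⟨e, ε, r, hε, hr, hcone⟩ := hΩ
  refine ⟨e, min ε 1, r, min r (min 1 (T / 4)), by positivity, hr, by positivity,
    (min_le_right _ _).trans (min_le_left _ _), ?_, ?_⟩
  all_goals
    rintro z ⟨hzx, hz1, hz2⟩ ρ hρ hρh y hy
    rw [Metric.mem_ball, Prod.dist_eq, max_lt_iff] at hy
    obtain ⟨hρr, hρ1, hρT⟩ : ρ ≤ r ∧ ρ ≤ 1 ∧ ρ ≤ T / 4 := by simpa only [le_min_iff] using hρh
    refine ⟨hcone z.1 hzx ρ ⟨hρ, hρr⟩ y.1 (hy.1.trans_le (min_le_left _ _)), ?_⟩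
    have hy2 := abs_lt.1 (hy.2.trans_le (min_le_right _ _))
    have hsq : ρ ^ 2 ≤ T / 4 := (pow_le_of_le_one hρ.le hρ1 two_ne_zero).trans hρT
    have hsq0 : 0 < ρ ^ 2 := by positivity
    simp only [Prod.snd_add, parabolicDilation_apply, Set.mem_Ioo]
    constructor <;> nlinarith

end InteriorCones

section DyadicTelescoping

/-- The power of the scale gained when the averages of `f` are compared in `L^r` with `f`, whose
parabolic derivatives are in `L^p`. Since `(⊤ : ℝ≥0∞).toReal⁻¹ = 0`, the formula covers `r = ∞`. -/
noncomputable def parabolicGain (n : ℕ) (p r : ℝ≥0∞) : ℝ :=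
  1 - (n + 2) * (p.toReal⁻¹ - r.toReal⁻¹)

theorem ofReal_inv_pow_mul_ofReal_pow_rpow (n : ℕ) (p r : ℝ≥0∞) {s : ℝ} (hs : 0 < s) :
    ENNReal.ofReal (s⁻¹ ^ (n + 1)) *
        ENNReal.ofReal (s ^ (n + 2)) ^ (1 - p.toReal⁻¹ + r.toReal⁻¹) =
      ENNReal.ofReal (s ^ parabolicGain n p r) := by
  rw [ENNReal.ofReal_rpow_of_pos (by positivity), ← ENNReal.ofReal_mul (by positivity),
    ← Real.rpow_natCast, ← Real.rpow_natCast, Real.inv_rpow hs.le, ← Real.rpow_neg hs.le,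
    ← Real.rpow_mul hs.le, ← Real.rpow_add hs, parabolicGain]
  congr 2
  push_cast
  ring

theorem enorm_image_sub_le_of_enorm_deriv_le {F : Type*} [NormedAddCommGroup F] [NormedSpace ℝ F]
    {f f' : ℝ → F} {a b : ℝ} (hab : a < b) (hf : ∀ x ∈ Set.Icc a b, HasDerivAt f (f' x) x)
    {K : ℝ≥0∞} (hK : ∀ x ∈ Set.Ico a b, ‖f' x‖ₑ ≤ K) :
    ‖f b - f a‖ₑ ≤ K * ENNReal.ofReal (b - a) := by
  rcases eq_or_ne K ⊤ with rfl | hKt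
  · simp [ENNReal.top_mul, hab]
  lift K to ℝ≥0 using hKt
  have hmean := norm_image_sub_le_of_norm_deriv_le_segment'
    (fun x hx => (hf x hx).hasDerivWithinAt) (C := K)
    (fun x hx => by exact_mod_cast hK x hx) b (Set.right_mem_Icc.2 hab.le)
  rw [← ofReal_norm, ← ENNReal.ofReal_coe_nnreal, ← ENNReal.ofReal_mul K.coe_nonneg]
  exact ENNReal.ofReal_le_ofReal hmean

variable {n : ℕ} {μ : Measure (E n × ℝ)} {U P : Set (E n × ℝ)} {φ f : E n × ℝ → ℝ}
  {G : E n × ℝ → ℝ≥0∞} {R h : ℝ} {C : ℝ≥0}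

theorem HasScaleDerivBound.enorm_kernelAverage_half_sub_le
    (hfG : HasScaleDerivBound μ φ P R h C f G) (hφ : IsTestIn U φ) (hR : 0 ≤ R)
    (hf : Integrable f μ) {z : E n × ℝ} (hz : z ∈ P) {s : ℝ} (hs : 0 < s) (hsh : s ≤ h) :
    ‖kernelAverage μ φ f (s / 2) z - kernelAverage μ φ f s z‖ₑ ≤
      C * ENNReal.ofReal ((s / 2)⁻¹ ^ (n + 1)) * ∫⁻ w in parabolicBox R s z, G w ∂μ := by
  have hs2 : 0 < s / 2 := half_pos hs
  have hderiv : ∀ ρ ∈ Set.Ico (s / 2) s,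
      ‖-(ρ⁻¹ * kernelAverage μ (scaleDerivKernel φ) f ρ z)‖ₑ ≤ ENNReal.ofReal (s / 2)⁻¹ *
        (C * ENNReal.ofReal ((s / 2)⁻¹ ^ (n + 1)) * ∫⁻ w in parabolicBox R s z, G w ∂μ) := by
    rintro ρ ⟨hsρ, hρs⟩
    have hρ : 0 < ρ := hs2.trans_le hsρ
    have hinv : ρ⁻¹ ≤ (s / 2)⁻¹ := inv_anti₀ hs2 hsρ
    rw [enorm_neg, enorm_mul, Real.enorm_of_nonneg (inv_nonneg.2 hρ.le)]
    refine mul_le_mul' (ENNReal.ofReal_le_ofReal hinv)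
      ((hfG z hz ρ hρ (hρs.le.trans hsh)).trans ?_)
    gcongr
    exact parabolicBox_mono hR hρ.le hρs.le z
  have hmean := enorm_image_sub_le_of_enorm_deriv_le (half_lt_self hs)
    (fun ρ hρ => hasDerivAt_kernelAverage hf hφ z (hs2.trans_le hρ.1)) hderiv
  rwa [sub_half, mul_right_comm, ← ENNReal.ofReal_mul (by positivity), inv_mul_cancel₀ hs2.ne',
    ENNReal.ofReal_one, one_mul, ← enorm_neg, neg_sub] at hmean

variable {p r : ℝ≥0∞}

theorem exists_eLpNorm_kernelAverage_half_sub_le [SFinite μ] (hμ : μ ≤ volume)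
    (hφ : IsTestIn U φ) (hR : 0 ≤ R) (C : ℝ≥0) (hP : MeasurableSet P) (hp : 1 ≤ p) (hpt : p ≠ ⊤)
    (hpr : p ≤ r) :
    ∃ C' : ℝ≥0, ∀ (f : E n × ℝ → ℝ) (G : E n × ℝ → ℝ≥0∞), Integrable f μ → Measurable G →
      ∀ h, HasScaleDerivBound μ φ P R h C f G → ∀ s, 0 < s → s ≤ h →
      eLpNorm (kernelAverage μ φ f (s / 2) - kernelAverage μ φ f s) r (μ.restrict P) ≤
        C' * ENNReal.ofReal (s ^ parabolicGain n p r) * eLpNorm G p μ := by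
  obtain ⟨c, hc⟩ := exists_volume_parabolicBox_le n hR
  set σ := 1 - p.toReal⁻¹ + r.toReal⁻¹ with hσ
  have hσ0 : 0 ≤ σ := by
    have hp1 : 1 ≤ p.toReal := by simpa using ENNReal.toReal_mono hpt hp
    linarith [inv_le_one_of_one_le₀ hp1, inv_nonneg.2 (r.toReal_nonneg)]
  refine ⟨C * 2 ^ (n + 1) * c ^ σ, fun f G hf hG h hfG s hs hsh => ?_⟩
  have hbox := eLpNorm_setLIntegral_le (measurableSet_setOf_mem_parabolicBox R s)
    (fun _ _ => mem_parabolicBox_symm) (fun z => (hμ _).trans (hc s hs z)) hp hpt hpr hG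
  rw [← hσ] at hbox
  calc eLpNorm (kernelAverage μ φ f (s / 2) - kernelAverage μ φ f s) r (μ.restrict P)
      ≤ (C * ENNReal.ofReal ((s / 2)⁻¹ ^ (n + 1))) *
          eLpNorm (fun z => ∫⁻ w in parabolicBox R s z, G w ∂μ) r (μ.restrict P) :=
        eLpNorm_le_mul_eLpNorm_of_ae_le_mul'
          (c := C * Real.toNNReal ((s / 2)⁻¹ ^ (n + 1)))
          (ae_restrict_of_forall_mem hP fun z hz =>
            hfG.enorm_kernelAverage_half_sub_le hφ hR hf hz hs hsh) r
    _ ≤ (C * ENNReal.ofReal ((s / 2)⁻¹ ^ (n + 1))) *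
          ((c * ENNReal.ofReal (s ^ (n + 2))) ^ σ * eLpNorm G p μ) := by
        gcongr
        exact (eLpNorm_mono_measure _ Measure.restrict_le_self).trans hbox
    _ = (C * 2 ^ (n + 1) * c ^ σ : ℝ≥0) * ENNReal.ofReal (s ^ parabolicGain n p r) *
          eLpNorm G p μ := by
        rw [← ofReal_inv_pow_mul_ofReal_pow_rpow n p r hs, ← hσ, inv_div, div_eq_mul_inv, mul_pow,
          ENNReal.ofReal_mul (by positivity), ENNReal.mul_rpow_of_nonneg _ _ hσ0]
        push_cast
        rw [ENNReal.coe_rpow_of_nonneg _ hσ0, ENNReal.ofReal_pow zero_le_two, ENNReal.ofReal_ofNat]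
        ring

theorem ofReal_dyadic_rpow {δ : ℝ} (hδ : 0 < δ) (θ : ℝ) (j : ℕ) :
    ENNReal.ofReal ((δ * (1 / 2) ^ j) ^ θ) =
      ENNReal.ofReal (δ ^ θ) * ((1 / 2 : ℝ≥0) ^ θ : ℝ≥0) ^ j := by
  rw [Real.mul_rpow hδ.le (by positivity), ENNReal.ofReal_mul (by positivity),
    ← Real.rpow_pow_comm (by norm_num), ENNReal.ofReal_pow (by positivity),
    ← ENNReal.ofReal_coe_nnreal]
  norm_num

theorem tendsto_dyadic_nhdsGT_zero {δ : ℝ} (hδ : 0 < δ) :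
    Filter.Tendsto (fun j : ℕ => δ * (1 / 2) ^ j) Filter.atTop (nhdsWithin 0 (Set.Ioi 0)) := by
  refine tendsto_nhdsWithin_iff.2 ⟨?_, .of_forall fun j => Set.mem_Ioi.2 (by positivity)⟩
  simpa only [mul_zero] using (tendsto_pow_atTop_nhds_zero_of_lt_one (r := (1 / 2 : ℝ))
    (by norm_num) (by norm_num)).const_mul δ

variable [IsFiniteMeasure μ] (hμ : μ ≤ volume) (hφ : IsTestIn U φ) (hP : MeasurableSet P)
  (hone : ∀ᶠ ρ in nhdsWithin 0 (Set.Ioi 0), ∀ z ∈ P, ∫ w, rescaledKernel φ z ρ w ∂μ = 1)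

include hμ hφ hP hone

theorem tendstoInMeasure_kernelAverage (hf : StronglyMeasurable f) (hfi : Integrable f μ)
    {s : ℕ → ℝ} (hs : Filter.Tendsto s Filter.atTop (nhdsWithin 0 (Set.Ioi 0))) :
    TendstoInMeasure (μ.restrict P) (fun j => kernelAverage μ φ f (s j)) Filter.atTop f :=
  tendstoInMeasure_of_tendsto_eLpNorm one_ne_zero
    (fun j => (stronglyMeasurable_kernelAverage hφ.1.continuous hf (s j)).aestronglyMeasurable)
    hf.aestronglyMeasurable
    ((tendsto_eLpNorm_one_kernelAverage_sub hμ hφ hone hP hf hfi).comp hs)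

theorem exists_eLpNorm_sub_kernelAverage_le (hR : 0 ≤ R) (C : ℝ≥0) (hp : 1 ≤ p) (hpt : p ≠ ⊤)
    (hpr : p ≤ r) (hθ : 0 < parabolicGain n p r) :
    ∃ C' : ℝ≥0, ∀ (f : E n × ℝ → ℝ) (G : E n × ℝ → ℝ≥0∞), StronglyMeasurable f →
      Integrable f μ → Measurable G → ∀ h, HasScaleDerivBound μ φ P R h C f G →
      ∀ δ, 0 < δ → δ ≤ h →
      eLpNorm (f - kernelAverage μ φ f δ) r (μ.restrict P) ≤
        C' * ENNReal.ofReal (δ ^ parabolicGain n p r) * eLpNorm G p μ := by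
  obtain ⟨C₁, hC₁⟩ := exists_eLpNorm_kernelAverage_half_sub_le hμ hφ hR C hP hp hpt hpr
  set θ := parabolicGain n p r
  set q : ℝ≥0 := (1 / 2 : ℝ≥0) ^ θ
  have hq1 : q < 1 := NNReal.rpow_lt_one (by norm_num) hθ
  refine ⟨C₁ * (1 - q)⁻¹, fun f G hf hfi hG h hfG δ hδ hδh => ?_⟩
  set s : ℕ → ℝ := fun j => δ * (1 / 2) ^ j with hs
  have hs0 : s 0 = δ := by simp only [hs, pow_zero, mul_one]
  have hhalf : ∀ j, s (j + 1) = s j / 2 := fun j => by simp only [hs]; ring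
  have hsδ : ∀ j, s j ≤ δ := fun j =>
    mul_le_of_le_one_right hδ.le (pow_le_one₀ (by norm_num) (by norm_num))
  have hstep : ∀ j, eLpNorm (kernelAverage μ φ f (s (j + 1)) - kernelAverage μ φ f (s j)) r
      (μ.restrict P) ≤ C₁ * ENNReal.ofReal (δ ^ θ) * eLpNorm G p μ * (q : ℝ≥0∞) ^ j := fun j => by
    have hgap := hC₁ f G hfi hG h hfG (s j) (by positivity) ((hsδ j).trans hδh)
    rw [← hhalf, ofReal_dyadic_rpow hδ θ j] at hgap
    exact hgap.trans_eq (by ring)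
  calc eLpNorm (f - kernelAverage μ φ f δ) r (μ.restrict P)
      ≤ ∑' j, eLpNorm (kernelAverage μ φ f (s (j + 1)) - kernelAverage μ φ f (s j)) r
          (μ.restrict P) := by
        rw [← hs0]
        exact eLpNorm_sub_le_tsum_of_tendstoInMeasure
          (fun j => (stronglyMeasurable_kernelAverage hφ.1.continuous hf _).aestronglyMeasurable)
          (tendstoInMeasure_kernelAverage hμ hφ hP hone hf hfi (tendsto_dyadic_nhdsGT_zero hδ))
          (hp.trans hpr)
    _ ≤ ∑' j, C₁ * ENNReal.ofReal (δ ^ θ) * eLpNorm G p μ * (q : ℝ≥0∞) ^ j :=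
        ENNReal.tsum_le_tsum hstep
    _ = (C₁ * (1 - q)⁻¹ : ℝ≥0) * ENNReal.ofReal (δ ^ θ) * eLpNorm G p μ := by
        rw [ENNReal.tsum_mul_left, ENNReal.tsum_geometric]
        push_cast [ENNReal.coe_inv (tsub_pos_of_lt hq1).ne']
        ring

end DyadicTelescoping

section FixedScale

variable {α : Type*} [NormedAddCommGroup α] {ψ : α → ℝ}

theorem exists_uniformContinuous_translate (hψ : Continuous ψ)
    (hc : HasCompactSupport ψ) :
    ∃ τ : α → BoundedContinuousFunction α ℝ, UniformContinuous τ ∧ ∀ z w, τ z w = ψ (w - z) := by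
  obtain ⟨C, hC⟩ := hψ.bounded_above_of_compact_support hc
  refine ⟨fun z => BoundedContinuousFunction.ofNormedAddCommGroup (fun w => ψ (w - z))
    (by fun_prop) C fun w => hC _, Metric.uniformContinuous_iff.2 fun ε hε => ?_, fun _ _ => rfl⟩
  obtain ⟨δ, hδ, hψδ⟩ := Metric.uniformContinuous_iff.1
    (hc.uniformContinuous_of_continuous hψ) (ε / 2) (half_pos hε)
  refine ⟨δ, hδ, fun {z z'} hz => lt_of_le_of_lt ?_ (half_lt_self hε)⟩
  refine (BoundedContinuousFunction.dist_le (half_pos hε).le).2 fun w => (hψδ ?_).le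
  rwa [dist_sub_left]

variable [MeasurableSpace α] [BorelSpace α] {μ ν : Measure α} [IsFiniteMeasure μ] {p : ℝ≥0∞}
  [Fact (1 ≤ p)]

variable (μ p) in
theorem exists_pairing_boundedContinuousFunction :
    ∃ B : BoundedContinuousFunction α ℝ →L[ℝ] Lp ℝ p μ →L[ℝ] ℝ,
      ∀ ψ f, B ψ f = ∫ w, f w * ψ w ∂μ := by
  have : Fact (1 ≤ p.conjExponent) := ⟨ENNReal.HolderConjugate.one_le _ p⟩
  refine ⟨((ContinuousLinearMap.mul ℝ ℝ).lpPairing μ p p.conjExponent).flip.comp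
    (BoundedContinuousFunction.toLp p.conjExponent μ ℝ), fun ψ f => ?_⟩
  rw [ContinuousLinearMap.comp_apply, ContinuousLinearMap.flip_apply,
    ContinuousLinearMap.lpPairing_eq_integral]
  refine integral_congr_ae ?_
  filter_upwards [BoundedContinuousFunction.coeFn_toLp (𝕜 := ℝ) p.conjExponent μ ψ] with w hw
  rw [hw, ContinuousLinearMap.mul_apply']

variable (μ p) in
theorem exists_uniformContinuous_pairing_translate (hψ : Continuous ψ)
    (hc : HasCompactSupport ψ) :
    ∃ l : α → Lp ℝ p μ →L[ℝ] ℝ, UniformContinuous l ∧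
      ∀ z f, l z f = ∫ w, f w * ψ (w - z) ∂μ := by
  obtain ⟨B, hB⟩ := exists_pairing_boundedContinuousFunction μ p
  obtain ⟨τ, hτ, hτψ⟩ := exists_uniformContinuous_translate hψ hc
  exact ⟨fun z => B (τ z), B.uniformContinuous.comp hτ, fun z f => by simp only [hB, hτψ]⟩

theorem smallModuloFunctionals_eLpNorm_integral_mul_translate [IsFiniteMeasure ν]
    (hψ : Continuous ψ) (hc : HasCompactSupport ψ) {P : Set α} (hPm : MeasurableSet P)
    (hP : TotallyBounded P) (r : ℝ≥0∞) :
    SmallModuloFunctionals fun f : Lp ℝ p μ =>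
      eLpNorm (fun z => ∫ w, f w * ψ (w - z) ∂μ) r (ν.restrict P) := by
  obtain ⟨l, hl, hlψ⟩ := exists_uniformContinuous_pairing_translate μ p hψ hc
  lift ν P ^ r.toReal⁻¹ to ℝ≥0 using
    ENNReal.rpow_ne_top_of_nonneg (by positivity) (measure_ne_top _ _) with M hM
  refine ((SmallModuloFunctionals.biSup_of_totallyBounded (hP.image hl)).const_mul M).mono
    fun f => ?_
  have hsup : ∀ z ∈ P, ‖∫ w, f w * ψ (w - z) ∂μ‖ₑ ≤ ⨆ l' ∈ l '' P, ‖l' f‖ₑ := fun z hz => by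
    rw [← hlψ]
    exact le_iSup₂_of_le (l z) (Set.mem_image_of_mem l hz) le_rfl
  refine (eLpNorm_le_of_ae_enorm_bound (ae_restrict_of_forall_mem hPm hsup)).trans_eq ?_
  rw [Measure.restrict_apply_univ, ← hM, smul_eq_mul, mul_comm]

end FixedScale

section PatchEstimate

variable {n : ℕ} {Ω : Opens (E n)} {T h : ℝ} {p r : ℝ≥0∞} {U P : Set (E n × ℝ)} {w₀ : E n × ℝ}
  {φ : E n × ℝ → ℝ}

theorem smallModuloFunctionals_eLpNorm_kernelAverage [Fact (1 ≤ p)] {μ : Measure (E n × ℝ)}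
    [IsFiniteMeasure μ] (hφ : IsTestIn U φ) {δ : ℝ} (hδ : δ ≠ 0) (hPm : MeasurableSet P)
    (hPb : Bornology.IsBounded P) (r : ℝ≥0∞) :
    SmallModuloFunctionals fun f : Lp ℝ p μ =>
      eLpNorm (kernelAverage μ φ f δ) r (μ.restrict P) := by
  have htranslate : ∀ z w, rescaledKernel φ z δ w = rescaledKernel φ 0 δ (w - z) := fun z w => by
    simp only [rescaledKernel, sub_zero]
  refine (smallModuloFunctionals_eLpNorm_integral_mul_translate (p := p) (μ := μ) (ν := μ)
    (contDiff_rescaledKernel hφ.1 0 δ).continuous (hasCompactSupport_rescaledKernel hφ.2.1 0 hδ)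
    hPm (hPb.isCompact_closure.totallyBounded.subset subset_closure) r).mono fun f => le_of_eq ?_
  simp only [← htranslate]
  rfl

theorem exists_isTestIn_integral_eq_one (hU : U ∈ nhds w₀) :
    ∃ φ : E n × ℝ → ℝ, IsTestIn U φ ∧ ∫ y, φ y = 1 := by
  obtain ⟨φ, hs, hc, hφ, hrange, hone⟩ := exists_contDiff_tsupport_subset (n := ⊤) hU
  have hpos : 0 < ∫ y, φ y :=
    hφ.continuous.integral_pos_of_hasCompactSupport_nonneg_nonzero hc
      (fun y => (hrange ⟨y, rfl⟩).1) (x := w₀) (hone ▸ one_ne_zero)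
  refine ⟨fun y => (∫ y, φ y)⁻¹ * φ y, IsTestIn.mul_left ⟨hφ, hc, hs⟩ contDiff_const, ?_⟩
  rw [integral_const_mul, inv_mul_cancel₀ hpos.ne']

theorem IsPatch.integral_rescaledKernel_cylMeasure (hP : IsPatch Ω T P U h) (hφ : IsTestIn U φ)
    {z : E n × ℝ} (hz : z ∈ P) {ρ : ℝ} (hρ : 0 < ρ) (hρh : ρ ≤ h) :
    ∫ w, rescaledKernel φ z ρ w ∂(cylMeasure Ω T) = ∫ y, φ y := by
  rw [← integral_rescaledKernel hφ.1.continuous z hρ]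
  refine setIntegral_eq_integral_of_forall_compl_eq_zero fun w hw => ?_
  refine image_eq_zero_of_notMem_tsupport fun hwφ => hw ?_
  have hmem := (hφ.isTest_rescaledKernel hρ.ne' (hP z hz ρ hρ hρh)).2.2 hwφ
  exact ⟨hmem.1, Set.Ioo_subset_Ioc_self hmem.2⟩

theorem exists_mul_ofReal_rpow_le {θ : ℝ} (hθ : 0 < θ) (C : ℝ≥0) (hh : 0 < h) {ε : ℝ≥0}
    (hε : 0 < ε) : ∃ δ : ℝ, 0 < δ ∧ δ ≤ h ∧ C * ENNReal.ofReal (δ ^ θ) ≤ ε := by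
  have hlim : Filter.Tendsto (fun δ : ℝ => C * ENNReal.ofReal (δ ^ θ))
      (nhdsWithin 0 (Set.Ioi 0)) (nhds 0) := by
    have hrpow := (Real.continuous_rpow_const hθ.le).tendsto 0
    rw [Real.zero_rpow hθ.ne'] at hrpow
    simpa using ENNReal.Tendsto.const_mul ((ENNReal.tendsto_ofReal hrpow).mono_left
      nhdsWithin_le_nhds) (Or.inr ENNReal.coe_ne_top) (a := (C : ℝ≥0∞))
  obtain ⟨δ, hδ, hδh⟩ := ((hlim.eventually_le_const (ENNReal.coe_pos.2 hε)).and
    (Ioc_mem_nhdsGT hh)).exists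
  exact ⟨δ, hδh.1, hδh.2, hδ⟩

theorem isFiniteMeasure_cylMeasure (hΩ : Bornology.IsBounded (Ω : Set (E n))) (T : ℝ) :
    IsFiniteMeasure (cylMeasure Ω T) :=
  isFiniteMeasure_restrict.2 (hΩ.prod (Metric.isBounded_Ioc 0 T)).measure_lt_top.ne

variable [IsFiniteMeasure (cylMeasure Ω T)] [Fact (1 ≤ p)] {X : Type*} [NormedAddCommGroup X]
  [NormedSpace ℝ X] (D : X →L[ℝ] Lp ℝ p (cylMeasure Ω T)) {G : X → E n × ℝ → ℝ≥0∞}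
  (hGm : ∀ u, Measurable (G u)) (hG : ∀ u, eLpNorm (G u) p (cylMeasure Ω T) ≤ ‖u‖ₑ)
  (hD : ∀ u, HasParabolicControl Ω T (D u) (G u)) (hpt : p ≠ ⊤) (hpr : p ≤ r)
  (hθ : 0 < parabolicGain n p r)

include hGm hG hD hpt hpr hθ

theorem exists_eLpNorm_sub_kernelAverage_le_of_isPatch (hP : IsPatch Ω T P U h) (hh : 0 < h)
    (hh1 : h ≤ 1) (hU : Bornology.IsBounded U) (hPm : MeasurableSet P) (hφ : IsTestIn U φ)
    (hone : ∫ y, φ y = 1) {ε : ℝ≥0} (hε : 0 < ε) :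
    ∃ δ : ℝ, 0 < δ ∧ ∀ u, eLpNorm (⇑(D u) - kernelAverage (cylMeasure Ω T) φ (D u) δ) r
      ((cylMeasure Ω T).restrict P) ≤ ε * ‖u‖ₑ := by
  obtain ⟨R, hR0, hR⟩ := Bornology.IsBounded.subset_closedBall_lt hU 0 0
  obtain ⟨C, hC⟩ := hP.exists_hasScaleDerivBound hh1 hφ hR
  have hone' : ∀ᶠ ρ : ℝ in nhdsWithin 0 (Set.Ioi 0), ∀ z ∈ P,
      ∫ w, rescaledKernel φ z ρ w ∂(cylMeasure Ω T) = 1 := by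
    filter_upwards [Ioc_mem_nhdsGT hh] with ρ hρ z hz
    rw [hP.integral_rescaledKernel_cylMeasure hφ hz hρ.1 hρ.2, hone]
  obtain ⟨C', hC'⟩ := exists_eLpNorm_sub_kernelAverage_le (μ := cylMeasure Ω T)
    Measure.restrict_le_self hφ hPm hone' hR0.le C Fact.out hpt hpr hθ
  obtain ⟨δ, hδ, hδh, hδε⟩ := exists_mul_ofReal_rpow_le hθ C' hh hε
  refine ⟨δ, hδ, fun u => ?_⟩
  have hint : Integrable (D u) (cylMeasure Ω T) := (Lp.memLp (D u)).integrable Fact.out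
  exact (hC' (D u) (G u) (Lp.stronglyMeasurable _) hint (hGm u) h (hC _ _ hint (hD u)) δ hδ
    hδh).trans (mul_le_mul' hδε (hG u))

theorem IsPatch.smallModuloFunctionals_eLpNorm (hP : IsPatch Ω T P U h) (hh : 0 < h)
    (hh1 : h ≤ 1) (hU : U ∈ nhds w₀) (hUb : Bornology.IsBounded U) (hPm : MeasurableSet P)
    (hPb : Bornology.IsBounded P) :
    SmallModuloFunctionals fun u => eLpNorm (D u) r ((cylMeasure Ω T).restrict P) := by
  obtain ⟨φ, hφ, hone⟩ := exists_isTestIn_integral_eq_one hU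
  intro ε hε
  obtain ⟨δ, hδ, hclose⟩ := exists_eLpNorm_sub_kernelAverage_le_of_isPatch D hGm hG hD hpt hpr hθ
    hP hh hh1 hUb hPm hφ hone (half_pos hε)
  obtain ⟨L, hL⟩ := (smallModuloFunctionals_eLpNorm_kernelAverage hφ hδ.ne' hPm hPb r).comp D
    (ε / 2) (half_pos hε)
  refine ⟨L, fun u => ?_⟩
  have hDu := Lp.stronglyMeasurable (D u)
  have havg := stronglyMeasurable_kernelAverage (μ := cylMeasure Ω T) hφ.1.continuous hDu δ
  calc eLpNorm (D u) r ((cylMeasure Ω T).restrict P)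
      = eLpNorm ((⇑(D u) - kernelAverage (cylMeasure Ω T) φ (D u) δ) +
          kernelAverage (cylMeasure Ω T) φ (D u) δ) r ((cylMeasure Ω T).restrict P) := by
        rw [sub_add_cancel]
    _ ≤ eLpNorm (⇑(D u) - kernelAverage (cylMeasure Ω T) φ (D u) δ) r
          ((cylMeasure Ω T).restrict P) +
        eLpNorm (kernelAverage (cylMeasure Ω T) φ (D u) δ) r ((cylMeasure Ω T).restrict P) :=
        eLpNorm_add_le (hDu.sub havg).aestronglyMeasurable havg.aestronglyMeasurable
          ((Fact.out : 1 ≤ p).trans hpr)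
    _ ≤ (ε / 2 : ℝ≥0) * ‖u‖ₑ + ((ε / 2 : ℝ≥0) * ‖u‖ₑ + (L.map fun l => ‖l u‖ₑ).sum) :=
        add_le_add (hclose u) (hL u)
    _ = ε * ‖u‖ₑ + (L.map fun l => ‖l u‖ₑ).sum := by
        rw [← add_assoc, ← add_mul, ← ENNReal.coe_add, add_halves]

theorem HasInteriorConeAt.exists_mem_nhds_smallModuloFunctionals {x₀ : E n}
    (hΩ : HasInteriorConeAt (Ω : Set (E n)) x₀) (hbdd : Bornology.IsBounded (Ω : Set (E n)))
    (hT : 0 < T) :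
    ∃ V ∈ nhds x₀, SmallModuloFunctionals fun u => eLpNorm (D u) r
      ((cylMeasure Ω T).restrict ((V ∩ Ω) ×ˢ Set.Ioc 0 T)) := by
  obtain ⟨e, ε, ρ, h, hε, hρ, hh, hh1, hlower, hupper⟩ := hΩ.exists_isPatch hT
  refine ⟨_, Metric.ball_mem_nhds x₀ hρ, ?_⟩
  have hsmall : ∀ {a b s : ℝ}, IsPatch Ω T ((Metric.ball x₀ ρ ∩ Ω) ×ˢ Set.Ioc a b)
      (Metric.ball (e, s) ε) h → SmallModuloFunctionals fun u => eLpNorm (D u) r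
        ((cylMeasure Ω T).restrict ((Metric.ball x₀ ρ ∩ Ω) ×ˢ Set.Ioc a b)) := fun hP =>
    hP.smallModuloFunctionals_eLpNorm D hGm hG hD hpt hpr hθ hh hh1
      (Metric.ball_mem_nhds _ hε) Metric.isBounded_ball
      ((Metric.isOpen_ball.inter Ω.isOpen).measurableSet.prod measurableSet_Ioc)
      ((hbdd.subset Set.inter_subset_right).prod (Metric.isBounded_Ioc _ _))
  refine ((hsmall hlower).add (hsmall hupper)).mono fun u => ?_
  rw [← Set.Ioc_union_Ioc_eq_Ioc (half_pos hT).le (half_le_self hT.le), Set.prod_union]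
  exact eLpNorm_restrict_union_le ((Fact.out : 1 ≤ p).trans hpr) _ _ _

omit [IsFiniteMeasure (cylMeasure Ω T)] in
theorem HasInteriorCones.smallModuloFunctionals_eLpNorm (hΩ : HasInteriorCones (Ω : Set (E n)))
    (hbdd : Bornology.IsBounded (Ω : Set (E n))) (hT : 0 < T) :
    SmallModuloFunctionals fun u => eLpNorm (D u) r (cylMeasure Ω T) := by
  have := isFiniteMeasure_cylMeasure hbdd T
  have hclosure : SmallModuloFunctionals fun u => eLpNorm (D u) r
      ((cylMeasure Ω T).restrict ((closure (Ω : Set (E n)) ∩ Ω) ×ˢ Set.Ioc 0 T)) := by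
    refine hbdd.isCompact_closure.induction_on
      (p := fun s => SmallModuloFunctionals fun u => eLpNorm (D u) r
        ((cylMeasure Ω T).restrict ((s ∩ (Ω : Set (E n))) ×ˢ Set.Ioc 0 T))) ?_ ?_ ?_ ?_
    · simpa using SmallModuloFunctionals.zero
    · intro s t hst ht
      refine ht.mono fun u => eLpNorm_mono_measure _ (Measure.restrict_mono ?_ le_rfl)
      gcongr
    · intro s t hs ht
      refine (hs.add ht).mono fun u => ?_
      rw [Set.union_inter_distrib_right, Set.union_prod]
      exact eLpNorm_restrict_union_le ((Fact.out : 1 ≤ p).trans hpr) _ _ _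
    · intro x hx
      obtain ⟨V, hV, hsmall⟩ := (hΩ x hx).exists_mem_nhds_smallModuloFunctionals D hGm hG hD hpt
        hpr hθ hbdd hT
      exact ⟨V, mem_nhdsWithin_of_mem_nhds hV, hsmall⟩
  have hrestrict : (cylMeasure Ω T).restrict ((Ω : Set (E n)) ×ˢ Set.Ioc 0 T) = cylMeasure Ω T :=
    Measure.restrict_restrict_of_subset le_rfl
  rwa [Set.inter_eq_right.2 subset_closure, hrestrict] at hclosure

end PatchEstimate

section SobolevSpaces

variable {n : ℕ} {Ω : Opens (E n)} {T : ℝ} {p r : ℝ≥0∞}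

theorem HasWeakDeriv.congr_ae {vs : List (E n × ℝ)} {f f' g g' : E n × ℝ → ℝ}
    (h : HasWeakDeriv Ω T vs f g) (hf : f =ᵐ[cylMeasure Ω T] f')
    (hg : g =ᵐ[cylMeasure Ω T] g') : HasWeakDeriv Ω T vs f' g' := fun φ hφ => by
  have hint : ∀ {k k' : E n × ℝ → ℝ} (ψ : E n × ℝ → ℝ), k =ᵐ[cylMeasure Ω T] k' →
      ∫ z, k z * ψ z ∂(cylMeasure Ω T) = ∫ z, k' z * ψ z ∂(cylMeasure Ω T) :=
    fun ψ hk => integral_congr_ae (hk.mul (.refl _ ψ))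
  rw [← hint _ hf, ← hint _ hg]
  exact h φ hφ

variable [Fact (1 ≤ p)]

theorem continuous_integral_mul_of_hasCompactSupport {α : Type*} [TopologicalSpace α]
    [MeasurableSpace α] [OpensMeasurableSpace α] {μ : Measure α} [IsFiniteMeasureOnCompacts μ]
    {ψ : α → ℝ} (hψ : Continuous ψ) (hc : HasCompactSupport ψ) :
    Continuous fun f : Lp ℝ p μ => ∫ w, f w * ψ w ∂μ := by
  have : Fact (1 ≤ p.conjExponent) := ⟨ENNReal.HolderConjugate.one_le _ p⟩
  have hmem : MemLp ψ p.conjExponent μ := hψ.memLp_of_hasCompactSupport hc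
  have hpairing : (fun f : Lp ℝ p μ => ∫ w, f w * ψ w ∂μ) = fun f =>
      (ContinuousLinearMap.mul ℝ ℝ).lpPairing μ p p.conjExponent f hmem.toLp := by
    ext f
    rw [ContinuousLinearMap.lpPairing_eq_integral]
    refine integral_congr_ae ?_
    filter_upwards [hmem.coeFn_toLp] with w hw
    rw [hw, ContinuousLinearMap.mul_apply']
  rw [hpairing]
  fun_prop

theorem isClosed_setOf_hasWeakDeriv (Ω : Opens (E n)) (T : ℝ) (p : ℝ≥0∞) [Fact (1 ≤ p)]
    (vs : List (E n × ℝ)) :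
    IsClosed {x : Lp ℝ p (cylMeasure Ω T) × Lp ℝ p (cylMeasure Ω T) |
      HasWeakDeriv Ω T vs x.1 x.2} := by
  have : IsFiniteMeasureOnCompacts (cylMeasure Ω T) :=
    inferInstanceAs (IsFiniteMeasureOnCompacts (volume.restrict (cylinder Ω T)))
  simp only [HasWeakDeriv, Set.ofPred_forall]
  refine isClosed_iInter fun φ => isClosed_iInter fun hφ => isClosed_eq ?_ ?_
  · exact (continuous_integral_mul_of_hasCompactSupport (contDiff_iterDeriv vs hφ.1).continuous
      (hasCompactSupport_iterDeriv vs hφ.2.1)).comp continuous_fst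
  · exact continuous_const.mul ((continuous_integral_mul_of_hasCompactSupport hφ.1.continuous
      hφ.2.1).comp continuous_snd)

variable {ι ι' : Type} {D : ι → List (E n × ℝ)} {D' : ι' → List (E n × ℝ)}

namespace Sobolev

theorem ext_ae {u v : Sobolev Ω T p D} (h : u.toLp =ᵐ[cylMeasure Ω T] v.toLp) : u = v :=
  Subtype.ext (Lp.ext h)

theorem wderiv_ae_eq [Fact (1 ≤ r)] {u : Sobolev Ω T p D} {v : Sobolev Ω T r D'}
    (h : v.toLp =ᵐ[cylMeasure Ω T] u.toLp) {i : ι} {j : ι'} (hij : D i = D' j)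
    (hi : MemLp (u.wderiv i) r (cylMeasure Ω T)) :
    v.wderiv j =ᵐ[cylMeasure Ω T] u.wderiv i := by
  have hweak : HasWeakDeriv Ω T (D' j) v.toLp hi.toLp :=
    (hij ▸ u.hasWeakDeriv i).congr_ae h.symm hi.coeFn_toLp.symm
  rw [(v.hasWeakDeriv j).unique hweak]
  exact hi.coeFn_toLp

theorem exists_linearMap_toLp_ae_eq [Fact (1 ≤ r)] {e : ι' → ι} (he : ∀ j, D (e j) = D' j)
    (h₀ : ∀ u : Sobolev Ω T p D, MemLp u.toLp r (cylMeasure Ω T))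
    (h₁ : ∀ (u : Sobolev Ω T p D) j, MemLp (u.wderiv (e j)) r (cylMeasure Ω T)) :
    ∃ J : Sobolev Ω T p D →ₗ[ℝ] Sobolev Ω T r D',
      ∀ u, (J u).toLp =ᵐ[cylMeasure Ω T] u.toLp := by
  let J : Sobolev Ω T p D → Sobolev Ω T r D' := fun u => ⟨(h₀ u).toLp, fun j =>
    ⟨(h₁ u j).toLp, (he j ▸ u.hasWeakDeriv (e j)).congr_ae (h₀ u).coeFn_toLp.symm
      (h₁ u j).coeFn_toLp.symm⟩⟩
  have hJ : ∀ u, (J u).toLp =ᵐ[cylMeasure Ω T] u.toLp := fun u => (h₀ u).coeFn_toLp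
  refine ⟨⟨⟨J, fun u v => ext_ae ?_⟩, fun c u => ext_ae ?_⟩, hJ⟩
  · refine (hJ (u + v)).trans ?_
    rw [map_add, map_add]
    exact (Lp.coeFn_add _ _).trans (((hJ u).add (hJ v)).symm.trans (Lp.coeFn_add _ _).symm)
  · refine (hJ (c • u)).trans ?_
    rw [map_smul, RingHom.id_apply, map_smul]
    exact (Lp.coeFn_smul _ _).trans (((hJ u).const_smul c).symm.trans (Lp.coeFn_smul _ _).symm)

variable [Fintype ι] [Fintype ι']

theorem enorm_eq (u : Sobolev Ω T p D) :
    ‖u‖ₑ = eLpNorm u.toLp p (cylMeasure Ω T) + ∑ i, eLpNorm (u.wderiv i) p (cylMeasure Ω T) := by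
  rw [← ofReal_norm, norm_eq, ENNReal.ofReal_add (norm_nonneg _)
    (Finset.sum_nonneg fun _ _ => norm_nonneg _), ENNReal.ofReal_sum_of_nonneg fun _ _ =>
    norm_nonneg _]
  simp only [ofReal_norm, Lp.enorm_def]

/-- The jet as a linear isometry, the norm of the Sobolev space being induced by it. -/
noncomputable def jetIsometry :
    Sobolev Ω T p D →ₗᵢ[ℝ] PiLp 1 (fun _ : Option ι => Lp ℝ p (cylMeasure Ω T)) :=
  ⟨jet, fun _ => rfl⟩

/-- The components of the jet as bounded operators: `u ↦ u` for `none`, `u ↦ D i u` for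
`some i`. -/
noncomputable def jetComponent (o : Option ι) :
    Sobolev Ω T p D →L[ℝ] Lp ℝ p (cylMeasure Ω T) :=
  (PiLp.proj 1 (fun _ : Option ι => Lp ℝ p (cylMeasure Ω T)) o).comp
    jetIsometry.toContinuousLinearMap

theorem range_jetIsometry :
    Set.range (jetIsometry : Sobolev Ω T p D →ₗᵢ[ℝ] _) =
      {F | ∀ i, HasWeakDeriv Ω T (D i) (F.ofLp none) (F.ofLp (some i))} := by
  ext F
  refine ⟨?_, fun hF => ?_⟩
  · rintro ⟨u, rfl⟩ i
    exact u.hasWeakDeriv i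
  · let u : Sobolev Ω T p D := ⟨F.ofLp none, fun i => ⟨_, hF i⟩⟩
    refine ⟨u, PiLp.ext fun o => ?_⟩
    cases o with
    | none => rfl
    | some i => exact (u.hasWeakDeriv i).unique (hF i)

instance completeSpace : CompleteSpace (Sobolev Ω T p D) := by
  have hclosed : IsClosed (Set.range (jetIsometry : Sobolev Ω T p D →ₗᵢ[ℝ] _)) := by
    rw [range_jetIsometry, Set.ofPred_forall]
    refine isClosed_iInter fun i => (isClosed_setOf_hasWeakDeriv Ω T p (D i)).preimage
      (f := fun F : PiLp 1 (fun _ : Option ι => Lp ℝ p (cylMeasure Ω T)) =>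
        (F.ofLp none, F.ofLp (some i))) ?_
    exact (PiLp.continuous_apply _ _ _).prodMk (PiLp.continuous_apply _ _ _)
  exact (completeSpace_iff_isComplete_range
    (jetIsometry (D := D)).isometry.isUniformInducing).2 hclosed.isComplete

theorem exists_isCompactOperator [Fact (1 ≤ r)] {e : ι' → ι} (he : ∀ j, D (e j) = D' j)
    (h₀ : SmallModuloFunctionals fun u : Sobolev Ω T p D => eLpNorm u.toLp r (cylMeasure Ω T))
    (h₁ : ∀ j, SmallModuloFunctionals fun u : Sobolev Ω T p D =>
      eLpNorm (u.wderiv (e j)) r (cylMeasure Ω T)) :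
    ∃ J : Sobolev Ω T p D →L[ℝ] Sobolev Ω T r D',
      (∀ u, (J u).toLp =ᵐ[cylMeasure Ω T] u.toLp) ∧ Function.Injective J ∧
        IsCompactOperator J := by
  have hfinite : ∀ {q : Sobolev Ω T p D → ℝ≥0∞}, SmallModuloFunctionals q → ∀ u, q u < ⊤ :=
    fun hq u => hq.exists_le_mul_enorm.elim fun _ hC =>
      (hC u).trans_lt (ENNReal.mul_lt_top ENNReal.coe_lt_top enorm_lt_top)
  have hmem : ∀ (u : Sobolev Ω T p D) j, MemLp (u.wderiv (e j)) r (cylMeasure Ω T) :=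
    fun u j => ⟨Lp.aestronglyMeasurable _, hfinite (h₁ j) u⟩
  obtain ⟨J, hJ⟩ := exists_linearMap_toLp_ae_eq he
    (fun u => ⟨Lp.aestronglyMeasurable _, hfinite h₀ u⟩) hmem
  have hsmall : SmallModuloFunctionals fun u => ‖J u‖ₑ := by
    refine (h₀.add (SmallModuloFunctionals.sum Finset.univ fun j _ => h₁ j)).mono fun u => ?_
    rw [enorm_eq, eLpNorm_congr_ae (hJ u)]
    exact add_le_add le_rfl (Finset.sum_le_sum fun j _ =>
      (eLpNorm_congr_ae (wderiv_ae_eq (hJ u) (he j) (hmem u j))).le)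
  obtain ⟨C, hC⟩ := hsmall.exists_le_mul_enorm
  refine ⟨J.mkContinuous C fun u => ?_, hJ, fun u v huv => ext_ae ?_,
    SmallModuloFunctionals.isCompactOperator hsmall⟩
  · have := hC u
    simp only [enorm_eq_nnnorm] at this
    exact_mod_cast this
  · exact (hJ u).symm.trans (by simpa [LinearMap.mkContinuous_apply] using huv ▸ hJ v)

end Sobolev

end SobolevSpaces

section Exponents

variable {n : ℕ} {p r : ℝ≥0∞}

theorem parabolicGain_pos_of_lt_div (hp : 1 ≤ p) (hpn : p < n + 2) (hpr : p ≤ r)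
    (hr : r < p * (n + 2) / (n + 2 - p)) : 0 < parabolicGain n p r := by
  have hnt : (n + 2 : ℝ≥0∞) ≠ ⊤ := by finiteness
  rw [ENNReal.lt_div_iff_mul_lt (.inl (tsub_pos_of_lt hpn).ne')
    (.inl (ENNReal.sub_ne_top hnt))] at hr
  lift p to ℝ≥0 using hpn.ne_top
  have hrt : r ≠ ⊤ := by
    rintro rfl
    rw [ENNReal.top_mul (tsub_pos_of_lt hpn).ne'] at hr
    exact not_top_lt hr
  lift r to ℝ≥0 using hrt
  have hp0 : (0 : ℝ) < p := lt_of_lt_of_le one_pos (by exact_mod_cast hp)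
  have hr0 : (0 : ℝ) < r := hp0.trans_le (by exact_mod_cast hpr)
  have hlt : (r : ℝ) * (n + 2 - p) < p * (n + 2) := by
    have hle : p ≤ n + 2 := by exact_mod_cast hpn.le
    have : r * (n + 2 - p) < p * (n + 2) := by exact_mod_cast hr
    rw [← NNReal.coe_lt_coe] at this
    push_cast [NNReal.coe_sub hle] at this
    exact this
  have hgain : parabolicGain n p r = (p * (n + 2) - r * (n + 2 - p)) / (p * r) := by
    simp only [parabolicGain, ENNReal.coe_toReal]
    field_simp
    ring
  rw [hgain]
  exact div_pos (sub_pos.2 hlt) (mul_pos hp0 hr0)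

theorem parabolicGain_pos_of_eq (hp : p = n + 2) (hr0 : r ≠ 0) (hr : r ≠ ⊤) :
    0 < parabolicGain n p r := by
  have hpn : p.toReal = n + 2 := by
    rw [hp]
    norm_cast
  have hr' : 0 < r.toReal := ENNReal.toReal_pos hr0 hr
  rw [parabolicGain, hpn, mul_sub, mul_inv_cancel₀ (by positivity), sub_sub_cancel]
  positivity

theorem parabolicGain_top_pos (hpn : n + 2 < p) (hp : p ≠ ⊤) : 0 < parabolicGain n p ⊤ := by
  lift p to ℝ≥0 using hp
  have hlt : (n + 2 : ℝ) < p := by exact_mod_cast hpn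
  have hp0 : (0 : ℝ) < p := lt_trans (by positivity) hlt
  rw [parabolicGain, ENNReal.coe_toReal, ENNReal.toReal_top, inv_zero, sub_zero,
    ← div_eq_mul_inv, sub_pos]
  exact (div_lt_one hp0).2 hlt

end Exponents

end ParabolicSobolev

open ParabolicSobolev in
theorem mainTheorem11_general {n : ℕ} (Ω : Opens (E n)) (hΩ : HasInteriorCones (Ω : Set (E n)))
    (hbdd : Bornology.IsBounded (Ω : Set (E n))) (T : ℝ) (hT : 0 < T)
    (p r : ℝ≥0∞) [Fact (1 ≤ p)] [Fact (1 ≤ r)] (hp : p ≠ ⊤) (hle : p ≤ r)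
    (hgain : 0 < parabolicGain n p r) :
    ∃ J : W21 Ω T p →L[ℝ] W10 Ω T r,
      (∀ u : W21 Ω T p, (J u).toLp =ᵐ[cylMeasure Ω T] u.toLp) ∧
        Function.Injective J ∧ IsCompactOperator J :=
  Sobolev.exists_isCompactOperator (e := fun k => Sum.inr (Sum.inl k)) (fun _ => rfl)
    (hΩ.smallModuloFunctionals_eLpNorm (Sobolev.jetComponent none) measurable_derivSum
      eLpNorm_derivSum_le hasParabolicControl_toLp hp hle hgain hbdd hT)
    fun k => hΩ.smallModuloFunctionals_eLpNorm (Sobolev.jetComponent (some (Sum.inr (Sum.inl k))))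
      measurable_derivSum eLpNorm_derivSum_le (hasParabolicControl_wderiv · k) hp hle hgain hbdd hT

theorem mainTheorem11 {n : ℕ} (hn : 1 ≤ n) (Ω : TopologicalSpace.Opens (ParabolicSobolev.E n))
    (hconn : IsConnected (Ω : Set (ParabolicSobolev.E n)))
    (hbdd : Bornology.IsBounded (Ω : Set (ParabolicSobolev.E n)))
    (hlip : ParabolicSobolev.HasLipschitzBoundary (Ω : Set (ParabolicSobolev.E n)))
    (T : ℝ) (hT : 0 < T)
    (p r : ℝ≥0∞) [Fact (1 ≤ p)] [Fact (1 ≤ r)]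
    (hle : p ≤ r)
    (hpr : (p < n + 2 ∧ p ≤ r ∧ r < p * (n + 2) / (n + 2 - p)) ∨
      (p = n + 2 ∧ n + 2 ≤ r ∧ r < ⊤) ∨
      (n + 2 < p ∧ p < ⊤ ∧ r = ⊤)) :
    ∃ J : ParabolicSobolev.W21 Ω T p →L[ℝ] ParabolicSobolev.W10 Ω T r,
      (∀ u : ParabolicSobolev.W21 Ω T p,
        (J u).toLp =ᵐ[ParabolicSobolev.cylMeasure Ω T] u.toLp) ∧
      Function.Injective J ∧ IsCompactOperator J := by
  have hp : p ≠ ⊤ := by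
    rcases hpr with ⟨hpn, -⟩ | ⟨rfl, -⟩ | ⟨-, hp, -⟩
    exacts [hpn.ne_top, by finiteness, hp.ne]
  have hgain : 0 < ParabolicSobolev.parabolicGain n p r := by
    rcases hpr with ⟨hpn, -, hr⟩ | ⟨hpn, -, hr⟩ | ⟨hpn, hp, rfl⟩
    · exact ParabolicSobolev.parabolicGain_pos_of_lt_div Fact.out hpn hle hr
    · exact ParabolicSobolev.parabolicGain_pos_of_eq hpn (one_pos.trans_le Fact.out).ne' hr.ne
    · exact ParabolicSobolev.parabolicGain_top_pos hpn hp.ne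
  exact mainTheorem11_general Ω (hlip.hasInteriorCones) hbdd T hT p r hp hle hgain
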